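/- Let $\Sigma$ be a set of propositional atoms and $\mathcal{A}$ a set of agents. **Language.** Formulas are built from the atoms $P\in\Sigma$ and $\bot$ by $\neg$, $\wedge$, the operators $K_A$ ("$A$ knows") and $M_A$ ("$A$ knows at most") for $A\in\mathcal{A}$, and the operators $E_G$ ("everyone in $G$ knows") and $C_G$ ("common knowledge in $G$") for $G\subseteq\mathcal{A}$. We write $\varphi\Rightarrow\psi$ for $\neg(\varphi\wedge\neg\psi)$, $\varphi\Leftrightarrow\psi$ for $(\varphi\Rightarrow\psi)\wedge(\psi\Rightarrow\varphi)$, and $O_A\varphi$ ("$A$ only knows $\varphi$") for $K_A\varphi\wedge M_A\varphi$. **Prebiworlds.** By transfinite recursion on the ordinal $\mu$, define the $\mu$-prebiworlds $w$, their objective interpretation $w^{\mathrm{obj}}\subseteq\Sigma$ and their restrictions $w|_\alpha$ to $\alpha\le\mu$. A $0$-prebiworld is an interpretation $I\subseteq\Sigma$. A $(\mu+1)$-prebiworld is a triple $(I,(A^w)_{A\in\mathcal{A}},(\bar A^w)_{A\in\mathcal{A}})$ with $I\subseteq\Sigma$ and $A^w,\bar A^w$ sets of $\mu$-prebiworlds.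 For a limit ordinal $\lambda$, a $\lambda$-prebiworld is a sequence $(w_\alpha)_{\alpha<\lambda}$ of $\alpha$-prebiworlds $w_\alpha$ with $w_\alpha|_\beta=w_\beta$ for $\beta\le\alpha<\lambda$. The objective interpretation of $w$ is $I$ in the first two cases and $w_0$ in the third. If $w$ has depth $\mu$, then $w|_0=w^{\mathrm{obj}}$; for a limit ordinal $\alpha$, $w|_\alpha=(w|_\beta)_{\beta<\alpha}$; if $\mu$ is a limit, $w|_{\alpha+1}=w_{\alpha+1}$; and if $\mu$ is a successor, $w|_{\alpha+1}$ is the triple with interpretation $w^{\mathrm{obj}}$ and sets $\{v|_\alpha : v\in A^w\}$ and $\{v|_\alpha : v\in\bar A^w\}$. **Biworlds.** Every $0$-prebiworld is a $0$-biworld. For a limit $\lambda$, a $\lambda$-prebiworld $w$ is a $\lambda$-biworld if every $w_\alpha$ is an $\alpha$-biworld. Given the $\mu$-biworlds, the incompleted $\mu$-prebiworlds and the $(\mu+1)$-biworlds are the least sets such that: a $\mu$-prebiworld $w$ is incompleted if there are two distinct $(\mu+1)$-biworlds $v_1,v_2$ with $v_1|_\mu=v_2|_\mu=w$; and a $(\mu+1)$-prebiworld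 $w$ is a $(\mu+1)$-biworld if, for every agent $A$, $A^w\cup\bar A^w$ is the set of all $\mu$-biworlds and every element of $A^w\cap\bar A^w$ is incompleted. A prebiworld is completed if it is not incompleted. **Canonical structure and entailment.** Let $\mathcal{K}^*$ be the Kripke structure whose worlds are the completed $(\omega^2+1)$-biworlds, with $w\,R_A\,w'$ iff $w'|_{\omega^2}\in A^w$. Truth at a world $w$ of $\mathcal{K}^*$ is two-valued: an atom $P$ is true iff $P\in w^{\mathrm{obj}}$; $\bot$ is never true; $\neg,\wedge$ are classical; $K_A\varphi$ is true at $w$ iff $\varphi$ is true at all $w'$ with $w\,R_A\,w'$; $M_A\varphi$ is true at $w$ iff $w\,R_A\,w'$ for every world $w'$ at which $\varphi$ is true; $E_G\varphi$ is true at $w$ iff $K_A\varphi$ is for every $A\in G$; and $C_G\varphi$ is true at $w$ iff $E_G^k\varphi$ is for every $k\ge1$, where $E_G^0\varphi=\varphi$ and $E_G^{k+1}\varphi=E_G(E_G^k\varphi)$. For a set $\Gamma$ of formulas, $\Gamma\models\varphi$ means that $\varphi$ is true at every world of $\mathcal{K}^*$ at which all formulas of $\Gamma$ are true; $\models\varphi$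 means $\emptyset\models\varphi$. **Theorem.** For all formulas $\varphi,\psi$, all sets of formulas $\Gamma,\Gamma'$, every agent $A\in\mathcal{A}$ and every non-empty $G\subseteq\mathcal{A}$: 1. (Prop) If $\varphi$ is a substitution instance of a propositional tautology, then $\models\varphi$. 2. (MP) $\varphi,\ \varphi\Rightarrow\psi\models\psi$. 3. (Mono) If $\Gamma\models\varphi$, then $\Gamma,\psi\models\varphi$. 4. (Cut) If $\Gamma\models\varphi$ and $\Gamma',\varphi\models\psi$, then $\Gamma,\Gamma'\models\psi$. 5. (K) $\models(K_A(\varphi\Rightarrow\psi)\wedge K_A\varphi)\Rightarrow K_A\psi$. 6. (Nec) If $\models\varphi$, then $\models K_A\varphi$. 7. (M) If $\varphi\not\models\psi$, then $M_A\varphi\models\neg K_A\psi$. 8. (O) $O_A\varphi\not\models\bot$. 9. (Fixed point axiom) $\models C_G\varphi\Leftrightarrow E_G(\varphi\wedge C_G\varphi)$. 10. (Induction rule) If $\varphi\models E_G(\varphi\wedge\psi)$, then $\varphi\models C_G\psi$. -/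

import Mathlib

/-!
The logic of common knowledge and only knowing, interpreted in the canonical Kripke structure
whose worlds are the completed biworlds of depth `ω ^ 2 + 1`.
-/

universe u v

namespace COL

open Order

noncomputable section

/-! ### Raw objects

`Raw μ` is the ambient type in which the prebiworlds of depth `μ` live.  It has the shape of a
prebiworld of depth `μ` (an interpretation, a triple, or a sequence), without the condition that
the sequences of limit length are increasing for the precision order. -/

/-- The shape of an object of depth `0`: an interpretation, given as the set of true atoms. -/
structure ZeroData (Atom : Type u) (Agent : Type v) : Type (max 1 u v) where
  obj : Set Atom

/-- The shape of an object of depth `μ + 1`, where `X` is the type of objects of depth `μ`: an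
interpretation and, for each agent, a set of possible and a set of impossible objects. -/
structure SuccData (Atom : Type u) (Agent : Type v) (X : Type (max 1 u v)) :
    Type (max 1 u v) where
  obj : Set Atom
  poss : Agent → Set X
  imposs : Agent → Set X

/-- Raw objects of depth `μ`; at a limit `l` they are sequences indexed by the ordinals `< l`. -/
def Raw (Atom : Type u) (Agent : Type v) (μ : Ordinal.{0}) : Type (max 1 u v) :=
  Ordinal.limitRecOn (motive := fun _ => Type (max 1 u v)) μ
    (ZeroData Atom Agent)
    (fun _ X => SuccData Atom Agent X)
    (fun l _ X => ∀ (a : Ordinal.{0}) (h : a < l), X a h)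

variable {Atom : Type u} {Agent : Type v}

theorem raw_zero : Raw Atom Agent 0 = ZeroData Atom Agent :=
  Ordinal.limitRecOn_zero _ _ _

theorem raw_succ (μ : Ordinal.{0}) :
    Raw Atom Agent (μ + 1) = SuccData Atom Agent (Raw Atom Agent μ) :=
  Ordinal.limitRecOn_add_one _ _ _ _

theorem raw_limit {l : Ordinal.{0}} (hl : IsSuccLimit l) :
    Raw Atom Agent l = ∀ (a : Ordinal.{0}), a < l → Raw Atom Agent a :=
  Ordinal.limitRecOn_limit _ _ _ _ hl

/-- A raw object of depth `0` is an interpretation. -/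
def zeroEquiv : Raw Atom Agent 0 ≃ ZeroData Atom Agent := Equiv.cast raw_zero

/-- A raw object of depth `μ + 1` is a triple. -/
def succEquiv (μ : Ordinal.{0}) :
    Raw Atom Agent (μ + 1) ≃ SuccData Atom Agent (Raw Atom Agent μ) := Equiv.cast (raw_succ μ)

/-- A raw object of limit depth is a sequence. -/
def limitEquiv {l : Ordinal.{0}} (hl : IsSuccLimit l) :
    Raw Atom Agent l ≃ (∀ (a : Ordinal.{0}), a < l → Raw Atom Agent a) :=
  Equiv.cast (raw_limit hl)

/-- The set `A ^ w`, for `w` of depth `μ + 1`. -/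
def poss {μ : Ordinal.{0}} (w : Raw Atom Agent (μ + 1)) (A : Agent) : Set (Raw Atom Agent μ) :=
  (succEquiv μ w).poss A

/-- The set `Ā ^ w`, for `w` of depth `μ + 1`. -/
def imposs {μ : Ordinal.{0}} (w : Raw Atom Agent (μ + 1)) (A : Agent) : Set (Raw Atom Agent μ) :=
  (succEquiv μ w).imposs A

/-- The element `(w)_a` of the sequence `w` of limit length `l`. -/
def proj {l : Ordinal.{0}} (hl : IsSuccLimit l) (w : Raw Atom Agent l) (a : Ordinal.{0})
    (h : a < l) : Raw Atom Agent a :=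
  limitEquiv hl w a h

/-- The objective interpretation; at limit depth it is the one of `(w)_0`. -/
def obj (μ : Ordinal.{0}) : Raw Atom Agent μ → Set Atom :=
  Ordinal.limitRecOn (motive := fun μ => Raw Atom Agent μ → Set Atom) μ
    (fun w => (zeroEquiv w).obj)
    (fun μ _ w => (succEquiv μ w).obj)
    (fun _ hl ih w => ih 0 hl.bot_lt (proj hl w 0 hl.bot_lt))

/-! ### Restriction and prebiworlds -/

theorem le_of_add_one_le {a b : Ordinal.{0}} (h : a + 1 ≤ b + 1) : a ≤ b :=
  lt_add_one_iff.1 (lt_of_lt_of_le (lt_add_one a) h)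

/-- The recursion on the target depth in the definition of the restriction of `w`: its value at
`0` is the objective interpretation of `w`, its value at a successor is given by `S`, and its
value at a limit is the sequence of the values at smaller ordinals. -/
def restrictTo (μ : Ordinal.{0}) (w : Raw Atom Agent μ)
    (S : ∀ a : Ordinal.{0}, a + 1 ≤ μ → Raw Atom Agent (a + 1)) (a : Ordinal.{0}) :
    a ≤ μ → Raw Atom Agent a :=
  Ordinal.limitRecOn (motive := fun a => a ≤ μ → Raw Atom Agent a) a
    (fun _ => zeroEquiv.symm ⟨obj μ w⟩)
    (fun a _ h => S a h)
    (fun _ hl ih h => (limitEquiv hl).symm fun b hb => ih b hb (hb.le.trans h))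

/-- `restrict μ a h w` is the restriction `w|_a` of `w` of depth `μ` to the depth `a ≤ μ`.  For
`a = a' + 1` it is the element `(w)_a` if `μ` is a limit, and if `μ = m + 1` it is the triple
with the interpretation of `w` whose sets are the images of those of `w` under `·|_{a'}`. -/
def restrict (μ : Ordinal.{0}) : ∀ a : Ordinal.{0}, a ≤ μ → Raw Atom Agent μ → Raw Atom Agent a :=
  Ordinal.limitRecOn
    (motive := fun μ => ∀ a : Ordinal.{0}, a ≤ μ → Raw Atom Agent μ → Raw Atom Agent a) μ
    (fun a h w => restrictTo 0 w
      (fun a' h' => absurd (lt_of_lt_of_le (lt_add_one a') h') not_lt_bot) a h)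
    (fun m ih a h w => restrictTo (m + 1) w
      (fun a' h' => (succEquiv a').symm
        ⟨obj (m + 1) w,
          fun A => ih a' (le_of_add_one_le h') '' poss w A,
          fun A => ih a' (le_of_add_one_le h') '' imposs w A⟩) a h)
    (fun l hl _ a h w => restrictTo l w
      (fun a' h' => proj hl w (a' + 1)
        (hl.add_one_lt (lt_of_lt_of_le (lt_add_one a') h'))) a h)

/-- The set of prebiworlds of depth `μ`. -/
def prebiworlds (μ : Ordinal.{0}) : Set (Raw Atom Agent μ) :=
  Ordinal.limitRecOn (motive := fun μ => Set (Raw Atom Agent μ)) μ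
    Set.univ
    (fun _ W => {w | ∀ A : Agent, poss w A ⊆ W ∧ imposs w A ⊆ W})
    (fun _ hl W => {w | (∀ a h, proj hl w a h ∈ W a h) ∧
      ∀ (b a : Ordinal.{0}) (hba : b ≤ a) (ha : a < _),
        restrict a b hba (proj hl w a ha) = proj hl w b (hba.trans_lt ha)})

/-! ### Incompleted prebiworlds and biworlds

At each level `μ`, once the set `B` of biworlds of depth `μ` is given, the incompleted prebiworlds
of depth `μ` and the biworlds of depth `μ + 1` are the least sets satisfying their definitions. -/

mutual

/-- `w` of depth `μ` is incompleted if two distinct biworlds of depth `μ + 1` extend it. -/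
inductive IncompletedOver (μ : Ordinal.{0}) (B : Set (Raw Atom Agent μ)) :
    Raw Atom Agent μ → Prop
  | intro (w : Raw Atom Agent μ) (v₁ v₂ : Raw Atom Agent (μ + 1))
      (hw : w ∈ prebiworlds μ)
      (hne : v₁ ≠ v₂)
      (h₁ : BiworldOver μ B v₁) (h₂ : BiworldOver μ B v₂)
      (hr₁ : restrict (μ + 1) μ (lt_add_one μ).le v₁ = w)
      (hr₂ : restrict (μ + 1) μ (lt_add_one μ).le v₂ = w) :
      IncompletedOver μ B w

/-- `w` of depth `μ + 1` is a biworld if `A ^ w ∪ Ā ^ w` is the set of all biworlds of depth `μ`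
and all elements of `A ^ w ∩ Ā ^ w` are incompleted. -/
inductive BiworldOver (μ : Ordinal.{0}) (B : Set (Raw Atom Agent μ)) :
    Raw Atom Agent (μ + 1) → Prop
  | intro (w : Raw Atom Agent (μ + 1))
      (hw : w ∈ prebiworlds (μ + 1))
      (hunion : ∀ A : Agent, poss w A ∪ imposs w A = B)
      (hinter : ∀ (A : Agent) (v : Raw Atom Agent μ), v ∈ poss w A → v ∈ imposs w A →
        IncompletedOver μ B v) :
      BiworldOver μ B w

end

/-- The set of biworlds of depth `μ`. -/
def biworlds (μ : Ordinal.{0}) : Set (Raw Atom Agent μ) :=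
  Ordinal.limitRecOn (motive := fun μ => Set (Raw Atom Agent μ)) μ
    (prebiworlds 0)
    (fun μ B => {w | BiworldOver μ B w})
    (fun l hl B => {w | w ∈ prebiworlds l ∧ ∀ a h, proj hl w a h ∈ B a h})

/-- The incompleted prebiworlds of depth `μ`. -/
def Incompleted (μ : Ordinal.{0}) (w : Raw Atom Agent μ) : Prop :=
  IncompletedOver μ (biworlds μ) w

/-- The completed prebiworlds of depth `μ`. -/
def Completed (μ : Ordinal.{0}) (w : Raw Atom Agent μ) : Prop :=
  w ∈ prebiworlds μ ∧ ¬ Incompleted μ w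

/-! ### Syntax -/

/-- Formulas over the atoms `Atom` and the agents `Agent`. -/
inductive Formula (Atom : Type u) (Agent : Type v) : Type (max u v)
  | atom (p : Atom)
  | bot
  | neg (φ : Formula Atom Agent)
  | and (φ ψ : Formula Atom Agent)
  | K (A : Agent) (φ : Formula Atom Agent)
  | M (A : Agent) (φ : Formula Atom Agent)
  | E (G : Set Agent) (φ : Formula Atom Agent)
  | C (G : Set Agent) (φ : Formula Atom Agent)

namespace Formula

/-- Material implication, `¬ (φ ∧ ¬ ψ)`. -/
def imp (φ ψ : Formula Atom Agent) : Formula Atom Agent := neg (and φ (neg ψ))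

/-- Equivalence. -/
def iff (φ ψ : Formula Atom Agent) : Formula Atom Agent := and (imp φ ψ) (imp ψ φ)

/-- Only knowing, `K_A φ ∧ M_A φ`. -/
def O (A : Agent) (φ : Formula Atom Agent) : Formula Atom Agent := and (K A φ) (M A φ)

end Formula

/-- Formulas of propositional logic, with the natural numbers as propositional variables. -/
inductive PropFormula : Type
  | var (n : ℕ)
  | bot
  | neg (τ : PropFormula)
  | and (τ σ : PropFormula)

namespace PropFormula

/-- Truth under an assignment of truth values to the variables. -/
def Holds (a : ℕ → Prop) : PropFormula → Prop
  | var n => a n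
  | bot => False
  | neg τ => ¬ τ.Holds a
  | and τ σ => τ.Holds a ∧ σ.Holds a

/-- Substitution of formulas for the propositional variables. -/
def subst (s : ℕ → Formula Atom Agent) : PropFormula → Formula Atom Agent
  | var n => s n
  | bot => .bot
  | neg τ => .neg (τ.subst s)
  | and τ σ => .and (τ.subst s) (σ.subst s)

end PropFormula

/-- A propositional tautology of the modal language: a substitution instance of a formula of
propositional logic that holds under all assignments. -/
def Formula.IsTautology (φ : Formula Atom Agent) : Prop :=
  ∃ (τ : PropFormula) (s : ℕ → Formula Atom Agent), (∀ a, τ.Holds a) ∧ φ = τ.subst s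

/-! ### Kripke semantics -/

/-- Kripke structures, whose worlds carry an interpretation of the atoms. -/
structure KripkeStructure (Atom : Type u) (Agent : Type v) : Type (max 2 (u + 1) (v + 1)) where
  World : Type (max 1 u v)
  val : World → Set Atom
  R : Agent → World → World → Prop

/-- Every agent in `G` knows the proposition `S`. -/
def KripkeStructure.everyoneKnows (𝒦 : KripkeStructure Atom Agent) (G : Set Agent)
    (S : 𝒦.World → Prop) (w : 𝒦.World) : Prop :=
  ∀ A ∈ G, ∀ w', 𝒦.R A w w' → S w'

/-- Two-valued truth of a formula at a world.  `C_G φ` holds if `E_G ^ k φ` holds for all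
`k ≥ 1`. -/
def KripkeStructure.Sat (𝒦 : KripkeStructure Atom Agent) :
    Formula Atom Agent → 𝒦.World → Prop
  | .atom p, w => p ∈ 𝒦.val w
  | .bot, _ => False
  | .neg φ, w => ¬ 𝒦.Sat φ w
  | .and φ ψ, w => 𝒦.Sat φ w ∧ 𝒦.Sat ψ w
  | .K A φ, w => ∀ w', 𝒦.R A w w' → 𝒦.Sat φ w'
  | .M A φ, w => ∀ w', 𝒦.Sat φ w' → 𝒦.R A w w'
  | .E G φ, w => 𝒦.everyoneKnows G (𝒦.Sat φ) w
  | .C G φ, w => ∀ k : ℕ, 1 ≤ k → (𝒦.everyoneKnows G)^[k] (𝒦.Sat φ) w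

/-! ### The canonical structure and entailment -/

/-- A world is a completed biworld of depth `ω ^ 2 + 1`. -/
def World (Atom : Type u) (Agent : Type v) : Type (max 1 u v) :=
  {w : Raw Atom Agent (Ordinal.omega0 ^ 2 + 1) //
    w ∈ biworlds (Ordinal.omega0 ^ 2 + 1) ∧ Completed (Ordinal.omega0 ^ 2 + 1) w}

/-- The structure `𝒦*` of all worlds, where `w'` is accessible for `A` from `w` if the restriction
of `w'` to the depth `ω ^ 2` belongs to `A ^ w`. -/
def canonical (Atom : Type u) (Agent : Type v) : KripkeStructure Atom Agent where
  World := World Atom Agent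
  val w := obj _ w.1
  R A w w' :=
    restrict (Ordinal.omega0 ^ 2 + 1) (Ordinal.omega0 ^ 2) (lt_add_one _).le w'.1 ∈ poss w.1 A

/-- `Γ ⊨ φ`: every world of `𝒦*` that satisfies all formulas in `Γ` satisfies `φ`. -/
def Entails (Γ : Set (Formula Atom Agent)) (φ : Formula Atom Agent) : Prop :=
  ∀ w : (canonical Atom Agent).World,
    (∀ ψ ∈ Γ, (canonical Atom Agent).Sat ψ w) → (canonical Atom Agent).Sat φ w

end

end COL

open COL

namespace COL

open Order

variable {Atom : Type u} {Agent : Type v}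

-- Nine of the ten properties hold in every Kripke structure once `M_A` quantifies over all worlds.
-- Only (O) depends on biworlds: for each `A` and `φ` some world must have as its `A`-successors
-- exactly the worlds satisfying `φ`.
--
-- The witness takes for `A ^ w` the set `P` of restrictions to `ω ^ 2` of the worlds satisfying
-- `φ`, and for `Ā ^ w` its complement among the biworlds. Two facts make this work.
--
-- Such a `w` is a world, because a biworld with disjoint pairs (`Decided`) is completed: all its
-- extensions are forced (`not_incompleted_of_decided`). And a world whose restriction lies in `P`
-- does satisfy `φ`, because the truth of `φ` depends only on the restriction to some depth below `ω
-- ^ 2` (`exists_determinedAt_sat`): `K`, `M` and `E` cost one level, `C` costs `ω`, and `ω ^ 2` is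
-- closed under addition.
--
-- The induction behind the second fact needs every biworld of depth `ω ^ 2` to extend to a world
-- (`exists_decided_extension`), and every world to be decided (`decided_of_not_incompleted`).
-- Decided extensions come from distributing the objects that are both possible and impossible. At
-- successor depth, each incompleted object has two extensions, one for either side. At limit depth,
-- one splits a space whose ambiguous points are not isolated into two suitably dense sets
-- (`exists_dense_partition`), which uses that the depth is countable. This existence is proved
-- together with the regular behaviour of biworlds under restriction (`regular`), by induction on
-- countable depths.

theorem zero_or_add_one_or_isSuccLimit (m : Ordinal.{0}) :
    m = 0 ∨ (∃ a, m = a + 1) ∨ IsSuccLimit m := by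
  rcases Ordinal.zero_or_succ_or_isSuccLimit m with h | ⟨a, rfl⟩ | h
  · exact .inl h
  · exact .inr (.inl ⟨a, rfl⟩)
  · exact .inr (.inr h)

/-! ### Unfolding the recursive definitions -/

theorem obj_zero (w : Raw Atom Agent 0) : obj 0 w = (zeroEquiv w).obj := by
  rw [obj, Ordinal.limitRecOn_zero]

theorem obj_succ {m : Ordinal.{0}} (w : Raw Atom Agent (m + 1)) :
    obj (m + 1) w = (succEquiv m w).obj := by
  rw [obj, Ordinal.limitRecOn_add_one]

theorem obj_limit {l : Ordinal.{0}} (hl : IsSuccLimit l) (w : Raw Atom Agent l) :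
    obj l w = obj 0 (proj hl w 0 hl.bot_lt) := by
  rw [obj, Ordinal.limitRecOn_limit (h := hl), obj]

theorem prebiworlds_zero : prebiworlds 0 = (Set.univ : Set (Raw Atom Agent 0)) := by
  rw [prebiworlds, Ordinal.limitRecOn_zero]

theorem mem_prebiworlds_succ {m : Ordinal.{0}} {w : Raw Atom Agent (m + 1)} :
    w ∈ prebiworlds (m + 1) ↔
      ∀ A : Agent, poss w A ⊆ prebiworlds m ∧ imposs w A ⊆ prebiworlds m := by
  rw [prebiworlds, Ordinal.limitRecOn_add_one]; rfl

theorem mem_prebiworlds_limit {l : Ordinal.{0}} (hl : IsSuccLimit l) {w : Raw Atom Agent l} :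
    w ∈ prebiworlds l ↔ (∀ a h, proj hl w a h ∈ prebiworlds a) ∧
      ∀ (b a : Ordinal.{0}) (hba : b ≤ a) (ha : a < l),
        restrict a b hba (proj hl w a ha) = proj hl w b (hba.trans_lt ha) := by
  rw [prebiworlds, Ordinal.limitRecOn_limit (h := hl)]; rfl

theorem biworlds_zero : biworlds 0 = (Set.univ : Set (Raw Atom Agent 0)) := by
  rw [biworlds, Ordinal.limitRecOn_zero, prebiworlds_zero]

theorem mem_biworlds_limit {l : Ordinal.{0}} (hl : IsSuccLimit l) {w : Raw Atom Agent l} :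
    w ∈ biworlds l ↔ w ∈ prebiworlds l ∧ ∀ a h, proj hl w a h ∈ biworlds a := by
  rw [biworlds, Ordinal.limitRecOn_limit (h := hl)]; rfl

theorem mem_biworlds_succ_iff_biworldOver {m : Ordinal.{0}} {w : Raw Atom Agent (m + 1)} :
    w ∈ biworlds (m + 1) ↔ BiworldOver m (biworlds m) w := by
  rw [biworlds, Ordinal.limitRecOn_add_one]; rfl

/-- This and `incompleted_iff` are the fixed point equations of the mutual definition; they suffice
for everything below, and minimality plays no role. -/
theorem mem_biworlds_succ {m : Ordinal.{0}} {w : Raw Atom Agent (m + 1)} :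
    w ∈ biworlds (m + 1) ↔ w ∈ prebiworlds (m + 1) ∧
      (∀ A : Agent, poss w A ∪ imposs w A = biworlds m) ∧
      ∀ (A : Agent) (v : Raw Atom Agent m), v ∈ poss w A → v ∈ imposs w A → Incompleted m v := by
  rw [mem_biworlds_succ_iff_biworldOver]
  constructor
  · rintro ⟨_, hw, hu, hi⟩
    exact ⟨hw, hu, hi⟩
  · rintro ⟨hw, hu, hi⟩
    exact ⟨w, hw, hu, hi⟩

theorem incompleted_iff {m : Ordinal.{0}} {w : Raw Atom Agent m} :
    Incompleted m w ↔ w ∈ prebiworlds m ∧ ∃ v₁ ∈ biworlds (m + 1), ∃ v₂ ∈ biworlds (m + 1),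
      v₁ ≠ v₂ ∧ restrict (m + 1) m (lt_add_one m).le v₁ = w ∧
        restrict (m + 1) m (lt_add_one m).le v₂ = w := by
  simp only [mem_biworlds_succ_iff_biworldOver]
  constructor
  · rintro ⟨_, v₁, v₂, hw, hne, h₁, h₂, hr₁, hr₂⟩
    exact ⟨hw, v₁, h₁, v₂, h₂, hne, hr₁, hr₂⟩
  · rintro ⟨hw, v₁, h₁, v₂, h₂, hne, hr₁, hr₂⟩
    exact ⟨w, v₁, v₂, hw, hne, h₁, h₂, hr₁, hr₂⟩

theorem biworlds_subset_prebiworlds {m : Ordinal.{0}} :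
    (biworlds m : Set (Raw Atom Agent m)) ⊆ prebiworlds m := by
  intro w hw
  rcases zero_or_add_one_or_isSuccLimit m with rfl | ⟨m, rfl⟩ | hl
  · rw [prebiworlds_zero]; trivial
  · exact (mem_biworlds_succ.1 hw).1
  · exact ((mem_biworlds_limit hl).1 hw).1

theorem raw_zero_ext {w w' : Raw Atom Agent 0} (h : obj 0 w = obj 0 w') : w = w' := by
  rw [obj_zero, obj_zero] at h
  apply zeroEquiv.injective
  cases hw : zeroEquiv w
  cases hw' : zeroEquiv w'
  simp_all

theorem raw_succ_ext {m : Ordinal.{0}} {w w' : Raw Atom Agent (m + 1)}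
    (h : obj (m + 1) w = obj (m + 1) w') (hp : ∀ A, poss w A = poss w' A)
    (hi : ∀ A, imposs w A = imposs w' A) : w = w' := by
  rw [obj_succ, obj_succ] at h
  replace hp : (succEquiv m w).poss = (succEquiv m w').poss := funext hp
  replace hi : (succEquiv m w).imposs = (succEquiv m w').imposs := funext hi
  apply (succEquiv m).injective
  cases hw : succEquiv m w
  cases hw' : succEquiv m w'
  simp_all

theorem raw_limit_ext {l : Ordinal.{0}} (hl : IsSuccLimit l) {w w' : Raw Atom Agent l}
    (h : ∀ a ha, proj hl w a ha = proj hl w' a ha) : w = w' :=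
  (limitEquiv hl).injective (funext fun a => funext fun ha => h a ha)

/-- The raw object of depth `m + 1` with the given components. -/
noncomputable def mkSucc {m : Ordinal.{0}} (I : Set Atom)
    (P N : Agent → Set (Raw Atom Agent m)) : Raw Atom Agent (m + 1) :=
  (succEquiv m).symm ⟨I, P, N⟩

@[simp]
theorem obj_mkSucc {m : Ordinal.{0}} (I : Set Atom) (P N : Agent → Set (Raw Atom Agent m)) :
    obj (m + 1) (mkSucc I P N) = I := by
  simp [obj_succ, mkSucc]

@[simp]
theorem poss_mkSucc {m : Ordinal.{0}} (I : Set Atom) (P N : Agent → Set (Raw Atom Agent m)) :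
    poss (mkSucc I P N) = P := by
  funext A; simp [poss, mkSucc]

@[simp]
theorem imposs_mkSucc {m : Ordinal.{0}} (I : Set Atom) (P N : Agent → Set (Raw Atom Agent m)) :
    imposs (mkSucc I P N) = N := by
  funext A; simp [imposs, mkSucc]

/-! ### Restriction -/

theorem exists_restrict_eq_restrictTo (m : Ordinal.{0}) (w : Raw Atom Agent m) :
    ∃ S : ∀ a : Ordinal.{0}, a + 1 ≤ m → Raw Atom Agent (a + 1),
      ∀ a h, restrict m a h w = restrictTo m w S a h := by
  rcases zero_or_add_one_or_isSuccLimit m with rfl | ⟨m, rfl⟩ | hl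
  · refine ⟨fun a h => absurd (lt_of_lt_of_le (lt_add_one a) h) not_lt_bot, fun a h => ?_⟩
    rw [restrict, Ordinal.limitRecOn_zero]
  · refine ⟨fun a h => mkSucc (obj (m + 1) w)
      (fun A => restrict m a (le_of_add_one_le h) '' poss w A)
      (fun A => restrict m a (le_of_add_one_le h) '' imposs w A), fun a h => ?_⟩
    rw [restrict, Ordinal.limitRecOn_add_one]
    rfl
  · refine ⟨fun a h => proj hl w (a + 1) (hl.add_one_lt (lt_of_lt_of_le (lt_add_one a) h)),
      fun a h => ?_⟩
    rw [restrict, Ordinal.limitRecOn_limit (h := hl)]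

theorem obj_restrict_zero {m : Ordinal.{0}} (h : 0 ≤ m) (w : Raw Atom Agent m) :
    obj 0 (restrict m 0 h w) = obj m w := by
  obtain ⟨S, hS⟩ := exists_restrict_eq_restrictTo m w
  rw [hS, restrictTo, Ordinal.limitRecOn_zero, obj_zero]
  simp

theorem proj_restrict {m l : Ordinal.{0}} (hl : IsSuccLimit l) (h : l ≤ m)
    (w : Raw Atom Agent m) (a : Ordinal.{0}) (ha : a < l) :
    proj hl (restrict m l h w) a ha = restrict m a (ha.le.trans h) w := by
  obtain ⟨S, hS⟩ := exists_restrict_eq_restrictTo m w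
  rw [hS, hS, restrictTo, Ordinal.limitRecOn_limit (h := hl)]
  simp [proj, restrictTo]

theorem restrict_succ_succ {m a : Ordinal.{0}} (h : a + 1 ≤ m + 1) (w : Raw Atom Agent (m + 1)) :
    restrict (m + 1) (a + 1) h w = mkSucc (obj (m + 1) w)
      (fun A => restrict m a (le_of_add_one_le h) '' poss w A)
      (fun A => restrict m a (le_of_add_one_le h) '' imposs w A) := by
  rw [restrict, Ordinal.limitRecOn_add_one, restrictTo, Ordinal.limitRecOn_add_one]
  rfl

theorem restrict_limit_succ {l a : Ordinal.{0}} (hl : IsSuccLimit l) (h : a + 1 ≤ l)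
    (w : Raw Atom Agent l) :
    restrict l (a + 1) h w =
      proj hl w (a + 1) (hl.add_one_lt (lt_of_lt_of_le (lt_add_one a) h)) := by
  rw [restrict, Ordinal.limitRecOn_limit (h := hl), restrictTo, Ordinal.limitRecOn_add_one]

/-- For limit `a` the left side is assembled from lower restrictions, so agreement with the stored
entry rests on coherence of the sequence. The entry itself has limit depth `a < l`, whence the outer
induction. -/
theorem restrict_limit {l a : Ordinal.{0}} (hl : IsSuccLimit l) {w : Raw Atom Agent l}
    (hw : w ∈ prebiworlds l) (h : a < l) : restrict l a h.le w = proj hl w a h := by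
  induction l using WellFoundedLT.induction generalizing a with | ind l ihl => ?_
  induction a using WellFoundedLT.induction with | ind a iha => ?_
  rcases zero_or_add_one_or_isSuccLimit a with rfl | ⟨a, rfl⟩ | ha
  · apply raw_zero_ext
    rw [obj_restrict_zero, obj_limit hl]
  · exact restrict_limit_succ hl _ w
  · have hp := (mem_prebiworlds_limit hl).1 hw
    refine raw_limit_ext ha fun b hb => ?_
    rw [proj_restrict, iha b hb (hb.trans h), ← ihl a h ha (hp.1 a h) hb, hp.2]

theorem restrict_self {m : Ordinal.{0}} {w : Raw Atom Agent m} (hw : w ∈ prebiworlds m) :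
    restrict m m le_rfl w = w := by
  induction m using Ordinal.limitRecOn with
  | zero => exact raw_zero_ext (obj_restrict_zero _ _)
  | add_one m ih =>
    have key : ∀ s : Set (Raw Atom Agent m), s ⊆ prebiworlds m →
        restrict m m le_rfl '' s = s := fun s hs =>
      (Set.image_congr fun x hx => ih (hs hx)).trans (Set.image_id' s)
    rw [restrict_succ_succ]
    rw [mem_prebiworlds_succ] at hw
    apply raw_succ_ext
    · simp
    · simp [key _ (hw _).1]
    · simp [key _ (hw _).2]
  | limit l hl _ =>
    exact raw_limit_ext hl fun a ha => by rw [proj_restrict, restrict_limit hl hw]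

theorem obj_restrict {m a : Ordinal.{0}} (h : a ≤ m) {w : Raw Atom Agent m}
    (hw : w ∈ prebiworlds m) : obj a (restrict m a h w) = obj m w := by
  rcases zero_or_add_one_or_isSuccLimit a with rfl | ⟨a, rfl⟩ | ha
  · exact obj_restrict_zero h w
  · rcases zero_or_add_one_or_isSuccLimit m with rfl | ⟨m, rfl⟩ | hm
    · exact absurd (lt_of_lt_of_le (lt_add_one a) h) not_lt_bot
    · simp [restrict_succ_succ]
    · have hp := (mem_prebiworlds_limit hm).1 hw
      rw [restrict_limit_succ hm, obj_limit hm, ← hp.2 0 (a + 1) (by simp), obj_restrict_zero]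
  · rw [obj_limit ha, proj_restrict, obj_restrict_zero]

theorem restrict_restrict {m b c : Ordinal.{0}} (hcb : c ≤ b) (hbm : b ≤ m)
    {w : Raw Atom Agent m} (hw : w ∈ prebiworlds m) :
    restrict b c hcb (restrict m b hbm w) = restrict m c (hcb.trans hbm) w := by
  induction m using Ordinal.limitRecOn generalizing b c with
  | zero =>
    obtain rfl : b = 0 := le_antisymm hbm (by simp)
    rw [restrict_self hw]
  | add_one m ih =>
    induction c using Ordinal.limitRecOn with
    | zero =>
      apply raw_zero_ext
      rw [obj_restrict_zero, obj_restrict_zero, obj_restrict _ hw]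
    | add_one c _ =>
      rcases zero_or_add_one_or_isSuccLimit b with rfl | ⟨b, rfl⟩ | hb
      · exact absurd (lt_of_lt_of_le (lt_add_one c) hcb) not_lt_bot
      · have key : ∀ s : Set (Raw Atom Agent m), s ⊆ prebiworlds m →
            restrict b c (le_of_add_one_le hcb) '' (restrict m b (le_of_add_one_le hbm) '' s) =
              restrict m c (le_of_add_one_le (hcb.trans hbm)) '' s := fun s hs => by
          rw [Set.image_image]
          exact Set.image_congr fun x hx => ih _ _ (hs hx)
        rw [mem_prebiworlds_succ] at hw
        rw [restrict_succ_succ, restrict_succ_succ, restrict_succ_succ]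
        simp only [obj_mkSucc, poss_mkSucc, imposs_mkSucc, key _ (hw _).1, key _ (hw _).2]
      · rw [restrict_limit_succ hb, proj_restrict]
    | limit c hc ih =>
      refine raw_limit_ext hc fun a ha => ?_
      rw [proj_restrict, proj_restrict, ih a ha]
  | limit l hl _ =>
    rcases hbm.eq_or_lt with rfl | hb
    · rw [restrict_self hw]
    · rw [restrict_limit hl hw hb, restrict_limit hl hw (hcb.trans_lt hb)]
      exact ((mem_prebiworlds_limit hl).1 hw).2 c b hcb hb

theorem restrict_mem_prebiworlds {m a : Ordinal.{0}} (h : a ≤ m) {w : Raw Atom Agent m}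
    (hw : w ∈ prebiworlds m) : restrict m a h w ∈ prebiworlds a := by
  induction m using Ordinal.limitRecOn generalizing a with
  | zero =>
    obtain rfl : a = 0 := le_antisymm h (by simp)
    rwa [restrict_self hw]
  | add_one m ih =>
    induction a using Ordinal.limitRecOn with
    | zero => rw [prebiworlds_zero]; trivial
    | add_one a _ =>
      rw [mem_prebiworlds_succ] at hw
      rw [restrict_succ_succ, mem_prebiworlds_succ]
      intro A
      simp only [poss_mkSucc, imposs_mkSucc]
      exact ⟨Set.image_subset_iff.2 fun x hx => ih _ ((hw A).1 hx),
        Set.image_subset_iff.2 fun x hx => ih _ ((hw A).2 hx)⟩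
    | limit a ha iha =>
      rw [mem_prebiworlds_limit ha]
      refine ⟨fun b hb => ?_, fun c b hcb hb => ?_⟩
      · rw [proj_restrict]; exact iha b hb _
      · rw [proj_restrict, proj_restrict, restrict_restrict _ _ hw]
  | limit l hl _ =>
    rcases h.eq_or_lt with rfl | h
    · rwa [restrict_self hw]
    · rw [restrict_limit hl hw h]
      exact ((mem_prebiworlds_limit hl).1 hw).1 a h

/-! ### Resolvability -/

section Resolvability

variable {T : Type*} (r : ℕ → Setoid T)

open Classical in
/-- A choice of representatives for the relations `r n` such that the representatives for `r n`
are also representatives for `r (n + 1)`. -/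
noncomputable def rep : ℕ → T → T
  | 0, u => (Quotient.mk (r 0) u).out
  | n + 1, u => if r (n + 1) (rep n u) u then rep n u else (Quotient.mk (r (n + 1)) u).out

theorem rep_rel (n : ℕ) (u : T) : r n (rep r n u) u := by
  cases n with
  | zero => exact Quotient.mk_out (s := r 0) u
  | succ n =>
    rw [rep]
    split_ifs with h
    · exact h
    · exact Quotient.mk_out (s := r (n + 1)) u

variable {r} (hr : Antitone r)
include hr

theorem rep_congr {n : ℕ} {u v : T} (h : r n u v) : rep r n u = rep r n v := by
  induction n with
  | zero => rw [rep, rep, Quotient.sound (s := r 0) h]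
  | succ n ih =>
    have ihn := ih (hr n.le_succ h)
    have : r (n + 1) (rep r n v) u ↔ r (n + 1) (rep r n v) v :=
      ⟨fun h' => (r (n + 1)).trans h' h, fun h' => (r (n + 1)).trans h' ((r (n + 1)).symm h)⟩
    rw [rep, rep, ihn, Quotient.sound (s := r (n + 1)) h]
    by_cases h1 : r (n + 1) (rep r n v) v
    · rw [if_pos h1, if_pos (this.2 h1)]
    · rw [if_neg h1, if_neg (mt this.1 h1)]

omit hr in
theorem rep_eq_self_of_le {n m : ℕ} (h : n ≤ m) {u : T} (hu : rep r n u = u) :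
    rep r m u = u := by
  induction m, h using Nat.le_induction with
  | base => exact hu
  | succ m _ ih => rw [rep, ih, if_pos ((r (m + 1)).refl u)]

/-- Resolvability of a space without isolated points, the classes of the `r n` being the basic open
sets. Points are sorted by the parity of the first level at which they are their own representative;
where splitting never stops, every late level occurs as a first level. -/
theorem exists_codense_set :
    ∃ E : Set T, ∀ (u : T) (n : ℕ),
      (∀ v, r n u v → ∀ m, ∃ v', r m v v' ∧ ¬ r (m + 1) v v') →
      (∃ v ∈ E, r n u v) ∧ ∃ v ∉ E, r n u v := by
  refine ⟨{u | ∃ k, Even k ∧ rep r k u = u ∧ ∀ j < k, rep r j u ≠ u}, fun u n hsplit => ?_⟩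
  -- The representative `s` of `u` at level `n` stays one at all later levels. A point splitting
  -- from `s` between `m` and `m + 1` has a new representative at `m + 1`: had it been one earlier,
  -- it would equal `s`, the representative of their common class at level `m`.
  have key : ∀ m ≥ n, ∃ y, r n u y ∧ rep r (m + 1) y = y ∧ ∀ j < m + 1, rep r j y ≠ y := by
    intro m hm
    have hu := rep_rel r n u
    have hs : rep r n (rep r n u) = rep r n u := rep_congr hr hu
    obtain ⟨v, hv, hv'⟩ := hsplit (rep r n u) ((r n).symm hu) m
    have hy := rep_rel r (m + 1) v
    have hys : r m (rep r (m + 1) v) (rep r n u) :=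
      (r m).trans (hr m.le_succ hy) ((r m).symm hv)
    refine ⟨rep r (m + 1) v, (r n).symm ((r n).trans (hr hm hys) hu), rep_congr hr hy,
      fun j hj h => hv' ?_⟩
    have h' := rep_eq_self_of_le (Nat.lt_succ_iff.1 hj) h
    rw [rep_congr hr hys, rep_eq_self_of_le hm hs] at h'
    rwa [← h'] at hy
  constructor
  · obtain ⟨y, h1, h2, h3⟩ := key (2 * n + 1) (by omega)
    exact ⟨y, ⟨_, ⟨n + 1, by omega⟩, h2, h3⟩, h1⟩
  · obtain ⟨y, h1, h2, h3⟩ := key (2 * n) (by omega)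
    refine ⟨y, ?_, h1⟩
    rintro ⟨k, hk, h2', h3'⟩
    rcases lt_trichotomy k (2 * n + 1) with h | h | h
    · exact h3 _ h h2'
    · subst h; exact (Nat.not_even_iff_odd.2 ⟨n, rfl⟩) hk
    · exact h3' _ h h2

/-- Points in only one of `P`, `N` have a forced side. An ambiguous point may go to either, and the
assignment must keep `D` dense in `P` and its complement dense in `N`. -/
theorem exists_dense_partition {P N : Set T} (hPN : ∀ u, u ∈ P ∨ u ∈ N)
    (hsplit : ∀ u, u ∈ P → u ∈ N → ∀ m, ∃ v, r m u v ∧ ¬ r (m + 1) u v) :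
    ∃ D : Set T, D ⊆ P ∧ Dᶜ ⊆ N ∧ (∀ u ∈ P, ∀ n, ∃ v ∈ D, r n u v) ∧
      ∀ u ∈ N, ∀ n, ∃ v ∈ Dᶜ, r n u v := by
  obtain ⟨E, hE⟩ := exists_codense_set hr
  -- An ambiguous limit of points outside `P` joins `D`, since those points already approximate it
  -- in the complement. A point interior to `P ∩ N` is sorted by `E`. The remaining ambiguous points
  -- are limits of points outside `N`, which lie in `D`, so they can be left out.
  refine ⟨{u | u ∈ P ∧ (u ∈ N → (∀ n, ∃ v, v ∉ P ∧ r n u v) ∨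
    ((∃ n, ∀ v, r n u v → v ∈ P ∧ v ∈ N) ∧ u ∈ E))}, fun u hu => hu.1, fun u hu => ?_, ?_, ?_⟩
  · by_contra h
    exact hu ⟨(hPN u).resolve_right h, fun h' => absurd h' h⟩
  · intro u hu n
    by_cases h1 : ∃ v, v ∉ N ∧ r n u v
    · obtain ⟨v, hv, huv⟩ := h1
      exact ⟨v, ⟨(hPN v).resolve_right hv, fun h' => absurd h' hv⟩, huv⟩
    push Not at h1
    by_cases h2 : ∀ k, ∃ v, v ∉ P ∧ r k u v
    · exact ⟨u, ⟨hu, fun _ => .inl h2⟩, (r n).refl u⟩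
    push Not at h2
    obtain ⟨k, hk⟩ := h2
    have hfull : ∀ v, r (max n k) u v → v ∈ P ∧ v ∈ N := fun v hv =>
      ⟨by_contra fun h => hk v h (hr (le_max_right n k) hv),
        by_contra fun h => h1 v h (hr (le_max_left n k) hv)⟩
    obtain ⟨⟨v, hvE, hv⟩, -⟩ :=
      hE u (max n k) fun v hv => hsplit v (hfull v hv).1 (hfull v hv).2
    exact ⟨v, ⟨(hfull v hv).1, fun _ => .inr
      ⟨⟨max n k, fun v' hv' => hfull v' ((r _).trans hv hv')⟩, hvE⟩⟩,
      hr (le_max_left n k) hv⟩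
  · intro u hu n
    by_cases h1 : ∃ v, v ∉ P ∧ r n u v
    · obtain ⟨v, hv, huv⟩ := h1
      exact ⟨v, fun h => hv h.1, huv⟩
    push Not at h1
    by_cases h2 : ∃ k, ∀ v, r k u v → v ∈ P ∧ v ∈ N
    · obtain ⟨k, hk⟩ := h2
      have hfull : ∀ v, r (max n k) u v → v ∈ P ∧ v ∈ N := fun v hv =>
        hk v (hr (le_max_right n k) hv)
      obtain ⟨-, v, hvE, hv⟩ :=
        hE u (max n k) fun v hv => hsplit v (hfull v hv).1 (hfull v hv).2
      have huv := hr (le_max_left n k) hv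
      refine ⟨v, fun h => ?_, huv⟩
      rcases h.2 (hfull v hv).2 with h' | h'
      · obtain ⟨v', hv', hvv'⟩ := h' n
        exact h1 v' hv' ((r n).trans huv hvv')
      · exact hvE h'.2
    · refine ⟨u, fun h => ?_, (r n).refl u⟩
      rcases h.2 hu with h' | h'
      · obtain ⟨v', hv', hvv'⟩ := h' n
        exact h1 v' hv' hvv'
      · exact h2 h'.1

end Resolvability

/-! ### Threads through a countable limit -/

-- Countability of `l` enters here. The gap `f n + 1 ≤ f (n + 1)` ensures that objects differing at
-- depth `f n + 1` still differ at the next term.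
open Ordinal Cardinal in
theorem exists_cofinal_seq {l : Ordinal.{0}} (hl : IsSuccLimit l) (hω : l < ω_ 1)
    {a : Ordinal.{0}} (ha : a < l) :
    ∃ f : ℕ → Ordinal.{0}, f 0 = a ∧ (∀ n, f n < l) ∧ (∀ n, f n + 1 ≤ f (n + 1)) ∧
      ∀ b < l, ∃ n, b ≤ f n := by
  have hc : Countable (Set.Iio l) := by
    rw [← Cardinal.mk_le_aleph0_iff, Cardinal.mk_Iio_ordinal, ← Cardinal.lift_aleph0.{1, 0},
      Cardinal.lift_le]
    rw [lt_omega_iff_card_lt, ← Cardinal.succ_aleph0, lt_succ_iff] at hω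
    simpa using hω
  have : Nonempty (Set.Iio l) := ⟨⟨a, ha⟩⟩
  obtain ⟨g, hg⟩ := exists_surjective_nat (Set.Iio l)
  let f : ℕ → Ordinal.{0} := fun n => Nat.rec a (fun n x => max (x + 1) (g n)) n
  refine ⟨f, rfl, fun n => ?_, fun n => le_max_left _ _, fun b hb => ?_⟩
  · induction n with
    | zero => exact ha
    | succ n ih => exact max_lt (hl.add_one_lt ih) (g n).2
  · obtain ⟨n, hn⟩ := hg ⟨b, hb⟩
    refine ⟨n + 1, ?_⟩
    have : ((g n : Set.Iio l) : Ordinal.{0}) ≤ f (n + 1) := le_max_right _ _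
    rwa [hn] at this

-- An inverse system with surjective maps and a countable cofinal sequence has a thread through any
-- given point: lift step by step along the sequence, then restrict to the depths in between.
open Ordinal in
theorem exists_thread {l : Ordinal.{0}} (hl : IsSuccLimit l) (hω : l < ω_ 1)
    (Q : ∀ a : Ordinal.{0}, Set (Raw Atom Agent a))
    (hQ : ∀ a < l, Q a ⊆ prebiworlds a)
    (down : ∀ (a b : Ordinal.{0}) (h : a ≤ b), b < l → ∀ w ∈ Q b, restrict b a h w ∈ Q a)
    (up : ∀ (a b : Ordinal.{0}) (h : a ≤ b), b < l → ∀ x ∈ Q a, ∃ w ∈ Q b, restrict b a h w = x)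
    {a : Ordinal.{0}} (ha : a < l) {x : Raw Atom Agent a} (hx : x ∈ Q a) :
    ∃ w ∈ prebiworlds l, restrict l a ha.le w = x ∧
      ∀ (b : Ordinal.{0}) (hb : b < l), restrict l b hb.le w ∈ Q b := by
  obtain ⟨f, rfl, hfl, hf, hcof⟩ := exists_cofinal_seq hl hω ha
  have hmono : Monotone f := monotone_nat_of_le_succ fun n => (lt_add_one _).le.trans (hf n)
  choose g hgQ hg using fun n => up (f n) (f (n + 1)) (hmono n.le_succ) (hfl _)
  let Z : ∀ n, {w : Raw Atom Agent (f n) // w ∈ Q (f n)} := fun n =>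
    Nat.rec ⟨x, hx⟩ (fun n z => ⟨g n z.1 z.2, hgQ n z.1 z.2⟩) n
  have hZ : ∀ n, restrict (f (n + 1)) (f n) (hmono n.le_succ) (Z (n + 1)).1 = (Z n).1 :=
    fun n => hg n (Z n).1 (Z n).2
  have hZpre : ∀ n, (Z n).1 ∈ prebiworlds (f n) := fun n => hQ _ (hfl n) (Z n).2
  have hZ' : ∀ n m (h : n ≤ m), restrict (f m) (f n) (hmono h) (Z m).1 = (Z n).1 := by
    intro n m h
    induction m, h using Nat.le_induction with
    | base => exact restrict_self (hZpre n)
    | succ m h ih => rw [← ih, ← hZ m, restrict_restrict _ _ (hZpre _)]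
  choose k hk using hcof
  let w : Raw Atom Agent l :=
    (limitEquiv hl).symm fun b hb => restrict (f (k b hb)) b (hk b hb) (Z (k b hb)).1
  have hproj : ∀ b hb, proj hl w b hb = restrict (f (k b hb)) b (hk b hb) (Z (k b hb)).1 := by
    intro b hb
    simp [w, proj]
  have key : ∀ b hb n (h : b ≤ f n), proj hl w b hb = restrict (f n) b h (Z n).1 := by
    intro b hb n h
    rw [hproj]
    rcases le_total n (k b hb) with h' | h'
    · rw [← hZ' _ _ h', restrict_restrict _ _ (hZpre _)]
    · rw [← hZ' _ _ h', restrict_restrict _ _ (hZpre _)]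
  have hw : w ∈ prebiworlds l := by
    rw [mem_prebiworlds_limit hl]
    refine ⟨fun b hb => ?_, fun c b hcb hb => ?_⟩
    · rw [hproj]; exact restrict_mem_prebiworlds _ (hZpre _)
    · rw [key c _ _ (hcb.trans (hk b hb)), hproj, restrict_restrict _ _ (hZpre _)]
  refine ⟨w, hw, ?_, fun b hb => ?_⟩
  · rw [restrict_limit hl hw ha, key _ _ 0 le_rfl, restrict_self (hZpre 0)]
    rfl
  · rw [restrict_limit hl hw hb, hproj]
    exact down _ _ _ (hfl _) _ (Z _).2

/-! ### Decided triples -/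

/-- An object of depth `m + 1` is decided if all its pairs `A ^ w`, `Ā ^ w` are disjoint. -/
def Decided {m : Ordinal.{0}} (w : Raw Atom Agent (m + 1)) : Prop :=
  ∀ A x, x ∈ poss w A → x ∉ imposs w A

theorem poss_subset_biworlds {m : Ordinal.{0}} {w : Raw Atom Agent (m + 1)}
    (hw : w ∈ biworlds (m + 1)) (A : Agent) : poss w A ⊆ biworlds m :=
  ((mem_biworlds_succ.1 hw).2.1 A) ▸ Set.subset_union_left

theorem imposs_subset_biworlds {m : Ordinal.{0}} {w : Raw Atom Agent (m + 1)}
    (hw : w ∈ biworlds (m + 1)) (A : Agent) : imposs w A ⊆ biworlds m :=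
  ((mem_biworlds_succ.1 hw).2.1 A) ▸ Set.subset_union_right

theorem mem_poss_or_mem_imposs {m : Ordinal.{0}} {w : Raw Atom Agent (m + 1)}
    (hw : w ∈ biworlds (m + 1)) (A : Agent) {x : Raw Atom Agent m} (hx : x ∈ biworlds m) :
    x ∈ poss w A ∨ x ∈ imposs w A := by
  rwa [← (mem_biworlds_succ.1 hw).2.1 A] at hx

theorem mkSucc_diff_mem_biworlds {m : Ordinal.{0}} (I : Set Atom)
    {P : Agent → Set (Raw Atom Agent m)} (hP : ∀ A, P A ⊆ biworlds m) :
    mkSucc I P (fun A => biworlds m \ P A) ∈ biworlds (m + 1) := by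
  rw [mem_biworlds_succ, mem_prebiworlds_succ]
  simp only [poss_mkSucc, imposs_mkSucc]
  exact ⟨fun A => ⟨(hP A).trans biworlds_subset_prebiworlds,
    Set.sdiff_subset.trans biworlds_subset_prebiworlds⟩,
    fun A => Set.union_sdiff_cancel (hP A), fun A v h h' => absurd h h'.2⟩

theorem decided_mkSucc_diff {m : Ordinal.{0}} (I : Set Atom)
    (P : Agent → Set (Raw Atom Agent m)) :
    Decided (mkSucc I P (fun A => biworlds m \ P A)) := by
  intro A x h h'
  simp only [poss_mkSucc, imposs_mkSucc] at h h'
  exact h'.2 h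

theorem poss_restrict {m a : Ordinal.{0}} (h : a + 1 ≤ m + 1) (w : Raw Atom Agent (m + 1))
    (A : Agent) :
    poss (restrict (m + 1) (a + 1) h w) A = restrict m a (le_of_add_one_le h) '' poss w A := by
  rw [restrict_succ_succ, poss_mkSucc]

theorem imposs_restrict {m a : Ordinal.{0}} (h : a + 1 ≤ m + 1) (w : Raw Atom Agent (m + 1))
    (A : Agent) :
    imposs (restrict (m + 1) (a + 1) h w) A =
      restrict m a (le_of_add_one_le h) '' imposs w A := by
  rw [restrict_succ_succ, imposs_mkSucc]

theorem poss_restrict_eq_image {m a b : Ordinal.{0}} (hab : a ≤ b) (hb : b + 1 ≤ m)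
    (ha : a + 1 ≤ m) {w : Raw Atom Agent m} (hw : w ∈ prebiworlds m) (A : Agent) :
    poss (restrict m (a + 1) ha w) A = restrict b a hab '' poss (restrict m (b + 1) hb w) A := by
  have h : a + 1 ≤ b + 1 := by gcongr
  rw [← restrict_restrict h hb hw, poss_restrict]

theorem imposs_restrict_eq_image {m a b : Ordinal.{0}} (hab : a ≤ b) (hb : b + 1 ≤ m)
    (ha : a + 1 ≤ m) {w : Raw Atom Agent m} (hw : w ∈ prebiworlds m) (A : Agent) :
    imposs (restrict m (a + 1) ha w) A =
      restrict b a hab '' imposs (restrict m (b + 1) hb w) A := by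
  have h : a + 1 ≤ b + 1 := by gcongr
  rw [← restrict_restrict h hb hw, imposs_restrict]

/-- The two sets of `w` cover all biworlds and their images at depth `a` are disjoint, so the image
of `x` tells on which side `x` lies. -/
theorem mem_poss_iff_of_decided {m a : Ordinal.{0}} (h : a + 1 ≤ m + 1)
    {w : Raw Atom Agent (m + 1)} (hw : w ∈ biworlds (m + 1))
    (hd : Decided (restrict (m + 1) (a + 1) h w)) (A : Agent) (x : Raw Atom Agent m) :
    x ∈ poss w A ↔ x ∈ biworlds m ∧
      restrict m a (le_of_add_one_le h) x ∈ poss (restrict (m + 1) (a + 1) h w) A := by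
  refine ⟨fun hx => ⟨poss_subset_biworlds hw A hx, ?_⟩, fun ⟨hx, hx'⟩ => ?_⟩
  · rw [poss_restrict]; exact Set.mem_image_of_mem _ hx
  · refine (mem_poss_or_mem_imposs hw A hx).resolve_right fun h' => hd A _ hx' ?_
    rw [imposs_restrict]; exact Set.mem_image_of_mem _ h'

theorem mem_imposs_iff_of_decided {m a : Ordinal.{0}} (h : a + 1 ≤ m + 1)
    {w : Raw Atom Agent (m + 1)} (hw : w ∈ biworlds (m + 1))
    (hd : Decided (restrict (m + 1) (a + 1) h w)) (A : Agent) (x : Raw Atom Agent m) :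
    x ∈ imposs w A ↔ x ∈ biworlds m ∧
      restrict m a (le_of_add_one_le h) x ∈ imposs (restrict (m + 1) (a + 1) h w) A := by
  refine ⟨fun hx => ⟨imposs_subset_biworlds hw A hx, ?_⟩, fun ⟨hx, hx'⟩ => ?_⟩
  · rw [imposs_restrict]; exact Set.mem_image_of_mem _ hx
  · refine (mem_poss_or_mem_imposs hw A hx).resolve_left fun h' => hd A _ ?_ hx'
    rw [poss_restrict]; exact Set.mem_image_of_mem _ h'

theorem not_incompleted_of_decided_restrict {m a : Ordinal.{0}} (h : a + 1 ≤ m)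
    {w : Raw Atom Agent m} (hd : Decided (restrict m (a + 1) h w)) : ¬ Incompleted m w := by
  rw [incompleted_iff]
  rintro ⟨-, v₁, hv₁, v₂, hv₂, hne, hr₁, hr₂⟩
  have hle : a + 1 ≤ m + 1 := h.trans (lt_add_one m).le
  have e₁ : restrict (m + 1) (a + 1) hle v₁ = restrict m (a + 1) h w := by
    rw [← hr₁, restrict_restrict _ _ (biworlds_subset_prebiworlds hv₁)]
  have e₂ : restrict (m + 1) (a + 1) hle v₂ = restrict m (a + 1) h w := by
    rw [← hr₂, restrict_restrict _ _ (biworlds_subset_prebiworlds hv₂)]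
  refine hne (raw_succ_ext ?_ (fun A => ?_) (fun A => ?_))
  · rw [← obj_restrict (lt_add_one m).le (biworlds_subset_prebiworlds hv₁),
      ← obj_restrict (lt_add_one m).le (biworlds_subset_prebiworlds hv₂), hr₁, hr₂]
  · ext x
    rw [mem_poss_iff_of_decided hle hv₁ (by rwa [e₁]), mem_poss_iff_of_decided hle hv₂
      (by rwa [e₂]), e₁, e₂]
  · ext x
    rw [mem_imposs_iff_of_decided hle hv₁ (by rwa [e₁]), mem_imposs_iff_of_decided hle hv₂
      (by rwa [e₂]), e₁, e₂]

theorem not_incompleted_of_decided {m : Ordinal.{0}} {w : Raw Atom Agent (m + 1)}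
    (hw : w ∈ prebiworlds (m + 1)) (hd : Decided w) : ¬ Incompleted (m + 1) w :=
  not_incompleted_of_decided_restrict le_rfl (by rwa [restrict_self hw])

/-! ### Restriction and extension of biworlds -/

/-- The behaviour of biworlds of depth `m` under restriction: restrictions are biworlds, biworlds
of smaller depth can be extended, and completed ones have only one extension. -/
structure Regular (Atom : Type u) (Agent : Type v) (m : Ordinal.{0}) : Prop where
  restrict_mem : ∀ w ∈ (biworlds m : Set (Raw Atom Agent m)), ∀ a h, restrict m a h w ∈ biworlds a
  exists_ext : ∀ a h, ∀ x ∈ (biworlds a : Set (Raw Atom Agent a)),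
    ∃ w ∈ biworlds m, restrict m a h w = x
  unique : ∀ a h, ∀ w₁ ∈ (biworlds m : Set (Raw Atom Agent m)), ∀ w₂ ∈ biworlds m,
    ¬ Incompleted a (restrict m a h w₁) → restrict m a h w₁ = restrict m a h w₂ → w₁ = w₂
  completed : ∀ a h, ∀ w ∈ (biworlds m : Set (Raw Atom Agent m)),
    ¬ Incompleted a (restrict m a h w) → ¬ Incompleted m w

theorem exists_decided_extension_zero (w : Raw Atom Agent 0) :
    ∃ v ∈ biworlds (0 + 1), restrict (0 + 1) 0 (lt_add_one 0).le v = w ∧ Decided v := by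
  refine ⟨_, mkSucc_diff_mem_biworlds (obj 0 w) (P := fun _ => ∅) (fun _ => Set.empty_subset _),
    raw_zero_ext ?_, decided_mkSucc_diff _ _⟩
  rw [obj_restrict_zero, obj_mkSucc]

/-- The extension of `w` that resolves the indeterminacy in `w` according to `E`. -/
theorem exists_decided_extension_succ {m : Ordinal.{0}} (H : Regular Atom Agent (m + 1))
    {E : Set (Raw Atom Agent (m + 1))}
    (hE : ∀ x : Raw Atom Agent m, Incompleted m x →
      (∃ v ∈ biworlds (m + 1), v ∈ E ∧ restrict (m + 1) m (lt_add_one m).le v = x) ∧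
      ∃ v ∈ biworlds (m + 1), v ∉ E ∧ restrict (m + 1) m (lt_add_one m).le v = x)
    {w : Raw Atom Agent (m + 1)} (hw : w ∈ biworlds (m + 1)) :
    ∃ v ∈ biworlds (m + 1 + 1), restrict (m + 1 + 1) (m + 1) (lt_add_one _).le v = w ∧
      Decided v ∧ ∀ A, ∀ x ∈ biworlds (m + 1),
        restrict (m + 1) m (lt_add_one m).le x ∈ poss w A →
        restrict (m + 1) m (lt_add_one m).le x ∈ imposs w A → (x ∈ poss v A ↔ x ∈ E) := by
  obtain ⟨hwp, hwu, hwi⟩ := mem_biworlds_succ.1 hw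
  -- Objects over an unambiguous restriction follow it; those over an ambiguous one follow `E`. Both
  -- sides then still project onto the sets of `w`, as `E` and its complement meet the fibre of each
  -- incompleted object.
  let P : Agent → Set (Raw Atom Agent (m + 1)) := fun A =>
    {x | x ∈ biworlds (m + 1) ∧ restrict (m + 1) m (lt_add_one m).le x ∈ poss w A ∧
      (restrict (m + 1) m (lt_add_one m).le x ∈ imposs w A → x ∈ E)}
  have hP : ∀ A, P A ⊆ biworlds (m + 1) := fun A x hx => hx.1
  refine ⟨_, mkSucc_diff_mem_biworlds (obj _ w) hP, ?_, decided_mkSucc_diff _ _, ?_⟩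
  · rw [restrict_succ_succ]
    refine raw_succ_ext (by simp) (fun A => ?_) (fun A => ?_)
    · rw [poss_mkSucc, poss_mkSucc]
      refine Set.Subset.antisymm (Set.image_subset_iff.2 fun x hx => hx.2.1) fun x hx => ?_
      by_cases hx' : x ∈ imposs w A
      · obtain ⟨⟨v, hv, hvE, rfl⟩, -⟩ := hE x (hwi A x hx hx')
        exact ⟨v, ⟨hv, hx, fun _ => hvE⟩, rfl⟩
      · obtain ⟨v, hv, rfl⟩ := H.exists_ext m (lt_add_one m).le x (poss_subset_biworlds hw A hx)
        exact ⟨v, ⟨hv, hx, fun h => absurd h hx'⟩, rfl⟩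
    · rw [imposs_mkSucc, imposs_mkSucc]
      refine Set.Subset.antisymm (Set.image_subset_iff.2 fun x hx => ?_) fun x hx => ?_
      · by_contra h
        exact hx.2 ⟨hx.1, (mem_poss_or_mem_imposs hw A (H.restrict_mem x hx.1 _ _)).resolve_right h,
          fun h' => absurd h' h⟩
      · by_cases hx' : x ∈ poss w A
        · obtain ⟨-, v, hv, hvE, rfl⟩ := hE x (hwi A x hx' hx)
          exact ⟨v, ⟨hv, fun h => hvE (h.2.2 hx)⟩, rfl⟩
        · obtain ⟨v, hv, rfl⟩ :=
            H.exists_ext m (lt_add_one m).le x (imposs_subset_biworlds hw A hx)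
          exact ⟨v, ⟨hv, fun h => hx' h.2.1⟩, rfl⟩
  · intro A x hx h1 h2
    rw [poss_mkSucc]
    exact ⟨fun h => h.2.2 h2, fun h => ⟨hx, h1, fun _ => h⟩⟩

theorem exists_splitting_set (m : Ordinal.{0}) :
    ∃ E : Set (Raw Atom Agent (m + 1)), ∀ x : Raw Atom Agent m, Incompleted m x →
      (∃ v ∈ biworlds (m + 1), v ∈ E ∧ restrict (m + 1) m (lt_add_one m).le v = x) ∧
      ∃ v ∈ biworlds (m + 1), v ∉ E ∧ restrict (m + 1) m (lt_add_one m).le v = x := by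
  choose f hf using fun x : {x : Raw Atom Agent m // Incompleted m x} => (incompleted_iff.1 x.2).2
  choose hf g hg hne hrf hrg using hf
  refine ⟨Set.range f, fun x hx => ⟨⟨f ⟨x, hx⟩, hf _, ⟨_, rfl⟩, hrf _⟩,
    g ⟨x, hx⟩, hg _, ?_, hrg _⟩⟩
  -- Restriction recovers `y` from `f y`, so only `f x` could equal `g x`, and those two differ.
  rintro ⟨y, hy⟩
  have h := hrf y
  rw [hy, hrg] at h
  obtain rfl : y = ⟨x, hx⟩ := Subtype.ext h.symm
  exact hne _ hy

-- View the biworlds of depth `l` as a space whose basic open sets are the fibres of restriction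
-- along a cofinal sequence. The threads through the possible sets of `w` and those through the
-- impossible sets cover it, and density of the chosen partition makes its two parts project onto
-- these sets at every depth below `l`.
open Ordinal in
theorem exists_decided_extension_limit {l : Ordinal.{0}} (hl : IsSuccLimit l) (hω : l < ω_ 1)
    (H : Regular Atom Agent l) {w : Raw Atom Agent l} (hw : w ∈ biworlds l) :
    ∃ v ∈ biworlds (l + 1), restrict (l + 1) l (lt_add_one l).le v = w ∧ Decided v := by
  have hwp := biworlds_subset_prebiworlds hw
  have hs : ∀ {b}, b < l → b + 1 ≤ l := fun hb => (hl.add_one_lt hb).le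
  have hwb : ∀ b (hb : b < l), restrict l (b + 1) (hs hb) w ∈ biworlds (b + 1) :=
    fun b hb => H.restrict_mem w hw _ _
  let P : Agent → Set {u : Raw Atom Agent l // u ∈ biworlds l} := fun A =>
    {u | ∀ b (hb : b < l), restrict l b hb.le u.1 ∈ poss (restrict l (b + 1) (hs hb) w) A}
  let N : Agent → Set {u : Raw Atom Agent l // u ∈ biworlds l} := fun A =>
    {u | ∀ b (hb : b < l), restrict l b hb.le u.1 ∈ imposs (restrict l (b + 1) (hs hb) w) A}
  obtain ⟨f, -, hfl, hf, hcof⟩ := exists_cofinal_seq hl hω hl.bot_lt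
  have hmono : Monotone f := monotone_nat_of_le_succ fun n => (lt_add_one _).le.trans (hf n)
  let r : ℕ → Setoid {u : Raw Atom Agent l // u ∈ biworlds l} := fun n =>
    Setoid.ker fun u => restrict l (f n) (hfl n).le u.1
  have hker : ∀ n u v, r n u v ↔
      restrict l (f n) (hfl n).le u.1 = restrict l (f n) (hfl n).le v.1 := fun n u v => Iff.rfl
  have hr_of_le : ∀ {a b} (hab : a ≤ b) (hb : b ≤ l)
      (u v : {u : Raw Atom Agent l // u ∈ biworlds l}),
      restrict l b hb u.1 = restrict l b hb v.1 →
      restrict l a (hab.trans hb) u.1 = restrict l a (hab.trans hb) v.1 := by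
    intro a b hab hb u v h
    rw [← restrict_restrict hab hb (biworlds_subset_prebiworlds u.2), h,
      restrict_restrict hab hb (biworlds_subset_prebiworlds v.2)]
  have hr : Antitone r := by
    intro n m h u v huv
    exact hr_of_le (hmono h) (hfl m).le u v huv
  have hPN : ∀ A u, u ∈ P A ∨ u ∈ N A := by
    intro A u
    by_contra! h
    obtain ⟨h1, h2⟩ := h
    simp only [P, N, Set.mem_ofPred_eq, not_forall] at h1 h2
    obtain ⟨a, ha, h1⟩ := h1
    obtain ⟨b, hb, h2⟩ := h2
    have hc := max_lt ha hb
    have hup := biworlds_subset_prebiworlds u.2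
    rcases mem_poss_or_mem_imposs (hwb _ hc) A (H.restrict_mem u.1 u.2 _ hc.le) with h | h
    · apply h1
      rw [poss_restrict_eq_image (le_max_left a b) (hs hc) (hs ha) hwp,
        ← restrict_restrict (le_max_left a b) hc.le hup]
      exact Set.mem_image_of_mem _ h
    · apply h2
      rw [imposs_restrict_eq_image (le_max_right a b) (hs hc) (hs hb) hwp,
        ← restrict_restrict (le_max_right a b) hc.le hup]
      exact Set.mem_image_of_mem _ h
  -- An ambiguous `u` has an incompleted restriction to depth `f n`. Of its two extensions to `f n +
  -- 1`, at least one is not the restriction of `u`, and it lifts back to depth `l`.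
  have hsplit : ∀ A u, u ∈ P A → u ∈ N A → ∀ n, ∃ v, r n u v ∧ ¬ r (n + 1) u v := by
    intro A u hP hN n
    have hinc := (mem_biworlds_succ.1 (hwb _ (hfl n))).2.2 A _ (hP _ (hfl n)) (hN _ (hfl n))
    obtain ⟨-, v₁, hv₁, v₂, hv₂, hne, hr₁, hr₂⟩ := incompleted_iff.1 hinc
    have hup := biworlds_subset_prebiworlds u.2
    have main : ∀ v ∈ biworlds (f n + 1),
        restrict (f n + 1) (f n) (lt_add_one _).le v = restrict l (f n) (hfl n).le u.1 →
        restrict l (f n + 1) (hs (hfl n)) u.1 ≠ v → ∃ v, r n u v ∧ ¬ r (n + 1) u v := by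
      intro v hv hvu hne
      obtain ⟨x, hx, rfl⟩ := H.exists_ext _ (hs (hfl n)) v hv
      refine ⟨⟨x, hx⟩, ?_, fun h => hne ?_⟩
      · rw [hker, ← hvu, restrict_restrict _ _ (biworlds_subset_prebiworlds hx)]
      · exact hr_of_le (hf n) (hfl (n + 1)).le u ⟨x, hx⟩ h
    by_cases h : restrict l (f n + 1) (hs (hfl n)) u.1 = v₁
    · exact main v₂ hv₂ hr₂ (h ▸ hne)
    · exact main v₁ hv₁ hr₁ h
  choose D hDP hDN hDP' hDN' using fun A => exists_dense_partition hr (hPN A) (hsplit A)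
  have thread : ∀ (Q : ∀ b, b < l → Set (Raw Atom Agent b)), (∀ b hb, Q b hb ⊆ biworlds b) →
      (∀ a b (hab : a ≤ b) (hb : b < l), Q a (hab.trans_lt hb) = restrict b a hab '' Q b hb) →
      ∀ a (ha : a < l), ∀ x ∈ Q a ha, ∃ u ∈ biworlds l, restrict l a ha.le u = x ∧
        ∀ b (hb : b < l), restrict l b hb.le u ∈ Q b hb := by
    intro Q hQ himg a ha x hx
    obtain ⟨u, hu, hux, huQ⟩ := exists_thread hl hω (fun b => {y | ∃ hb, y ∈ Q b hb})
      (fun b hb y hy => biworlds_subset_prebiworlds (hQ _ _ hy.2))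
      (fun a b hab hb y hy => ⟨hab.trans_lt hb, by
        rw [himg a b hab hb]; exact Set.mem_image_of_mem _ hy.2⟩)
      (fun a b hab hb y hy => by
        obtain ⟨_, hy⟩ := hy
        rw [himg a b hab hb] at hy
        obtain ⟨z, hz, rfl⟩ := hy
        exact ⟨z, ⟨hb, hz⟩, rfl⟩) ha ⟨ha, hx⟩
    refine ⟨u, ?_, hux, fun b hb => (huQ b hb).2⟩
    rw [mem_biworlds_limit hl]
    refine ⟨hu, fun b hb => ?_⟩
    rw [← restrict_limit hl hu hb]
    exact hQ _ _ (huQ b hb).2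
  have hDmem : ∀ A, Subtype.val '' D A ⊆ biworlds l := fun A =>
    Set.image_subset_iff.2 fun x _ => x.2
  have himgP : ∀ A b (hb : b < l), restrict l b hb.le '' (Subtype.val '' D A) =
      poss (restrict l (b + 1) (hs hb) w) A := by
    intro A b hb
    refine Set.Subset.antisymm ?_ fun x hx => ?_
    · rintro _ ⟨_, ⟨u, hu, rfl⟩, rfl⟩
      exact hDP A hu b hb
    · obtain ⟨u, hu, rfl, huQ⟩ := thread
        (fun b hb => poss (restrict l (b + 1) (hs hb) w) A)
        (fun b hb => poss_subset_biworlds (hwb b hb) A)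
        (fun a b hab hb => poss_restrict_eq_image hab (hs hb) (hs (hab.trans_lt hb)) hwp A) b hb x hx
      obtain ⟨n, hn⟩ := hcof b hb
      obtain ⟨v, hv, huv⟩ := hDP' A ⟨u, hu⟩ huQ n
      exact ⟨v.1, ⟨v, hv, rfl⟩, (hr_of_le hn (hfl n).le ⟨u, hu⟩ v huv).symm⟩
  have himgN : ∀ A b (hb : b < l), restrict l b hb.le '' (biworlds l \ Subtype.val '' D A) =
      imposs (restrict l (b + 1) (hs hb) w) A := by
    intro A b hb
    refine Set.Subset.antisymm ?_ fun x hx => ?_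
    · rintro _ ⟨u, ⟨hu, hu'⟩, rfl⟩
      exact hDN A (a := ⟨u, hu⟩) (fun h => hu' ⟨_, h, rfl⟩) b hb
    · obtain ⟨u, hu, rfl, huQ⟩ := thread
        (fun b hb => imposs (restrict l (b + 1) (hs hb) w) A)
        (fun b hb => imposs_subset_biworlds (hwb b hb) A)
        (fun a b hab hb => imposs_restrict_eq_image hab (hs hb) (hs (hab.trans_lt hb)) hwp A)
        b hb x hx
      obtain ⟨n, hn⟩ := hcof b hb
      obtain ⟨v, hv, huv⟩ := hDN' A ⟨u, hu⟩ huQ n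
      refine ⟨v.1, ⟨v.2, ?_⟩, (hr_of_le hn (hfl n).le ⟨u, hu⟩ v huv).symm⟩
      rintro ⟨v', hv', h⟩
      exact hv (Subtype.ext h ▸ hv')
  refine ⟨_, mkSucc_diff_mem_biworlds (obj l w) hDmem, ?_, decided_mkSucc_diff _ _⟩
  have hV := biworlds_subset_prebiworlds (mkSucc_diff_mem_biworlds (obj l w) hDmem)
  refine raw_limit_ext hl fun b hb => ?_
  have hsucc : restrict (l + 1) (b + 1) ((hs hb).trans (lt_add_one l).le)
      (mkSucc (obj l w) (fun A => Subtype.val '' D A)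
        (fun A => biworlds l \ Subtype.val '' D A)) = restrict l (b + 1) (hs hb) w := by
    rw [restrict_succ_succ]
    simp only [obj_mkSucc, poss_mkSucc, imposs_mkSucc, himgP _ b hb, himgN _ b hb]
    exact raw_succ_ext (by rw [obj_mkSucc, obj_restrict _ hwp]) (by simp) (by simp)
  rw [proj_restrict, ← restrict_restrict (lt_add_one b).le ((hs hb).trans (lt_add_one l).le) hV, hsucc, restrict_restrict _ _ hwp,
    restrict_limit hl hwp hb]

open Ordinal in
theorem exists_decided_extension {m : Ordinal.{0}} (hω : m < ω_ 1)
    (H : Regular Atom Agent m) {w : Raw Atom Agent m} (hw : w ∈ biworlds m) :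
    ∃ v ∈ biworlds (m + 1), restrict (m + 1) m (lt_add_one m).le v = w ∧ Decided v := by
  rcases zero_or_add_one_or_isSuccLimit m with rfl | ⟨m, rfl⟩ | hl
  · exact exists_decided_extension_zero w
  · obtain ⟨E, hE⟩ := exists_splitting_set (Atom := Atom) (Agent := Agent) m
    obtain ⟨v, hv, hvw, hd, -⟩ := exists_decided_extension_succ H hE hw
    exact ⟨v, hv, hvw, hd⟩
  · exact exists_decided_extension_limit hl hω H hw

-- A completed object has at most one extension, and a decided one exists.
open Ordinal in
theorem decided_of_not_incompleted_restrict {m : Ordinal.{0}} (hω : m < ω_ 1)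
    (H : Regular Atom Agent m) {v : Raw Atom Agent (m + 1)} (hv : v ∈ biworlds (m + 1))
    (hw : restrict (m + 1) m (lt_add_one m).le v ∈ biworlds m)
    (hc : ¬ Incompleted m (restrict (m + 1) m (lt_add_one m).le v)) : Decided v := by
  obtain ⟨v', hv', hvv', hd⟩ := exists_decided_extension hω H hw
  obtain rfl : v' = v := by
    by_contra hne
    exact hc (incompleted_iff.2 ⟨biworlds_subset_prebiworlds hw, v', hv', v, hv, hne, hvv', rfl⟩)
  exact hd

-- If the restriction to `a < m` is completed, the one to `a + 1` is decided, and this forces every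
-- extension of `w`.
open Ordinal in
theorem not_incompleted_of_restrict {m a : Ordinal.{0}} (hω : m < ω_ 1) (h : a ≤ m)
    (Ha : a < m → Regular Atom Agent a)
    (hR : ∀ w ∈ (biworlds m : Set (Raw Atom Agent m)), ∀ a h, restrict m a h w ∈ biworlds a)
    {w : Raw Atom Agent m} (hw : w ∈ biworlds m) (hc : ¬ Incompleted a (restrict m a h w)) :
    ¬ Incompleted m w := by
  have hwp := biworlds_subset_prebiworlds hw
  rcases h.eq_or_lt with rfl | h
  · rwa [restrict_self hwp] at hc
  · have h' : a + 1 ≤ m := add_one_le_of_lt h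
    refine not_incompleted_of_decided_restrict h' ?_
    refine decided_of_not_incompleted_restrict (h.trans hω) (Ha h) (hR _ hw _ _) ?_ ?_
    · rw [restrict_restrict _ _ hwp]; exact hR _ hw _ _
    · rwa [restrict_restrict _ _ hwp]

-- The four properties need each other: at a successor, extendability uses decided extensions one
-- level down, which rest on regularity there; at a limit, it is a thread.
open Ordinal in
theorem regular {m : Ordinal.{0}} (hω : m < ω_ 1) : Regular Atom Agent m := by
  induction m using WellFoundedLT.induction with | ind m ih => ?_
  suffices h : (∀ w ∈ (biworlds m : Set (Raw Atom Agent m)), ∀ a h,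
      restrict m a h w ∈ biworlds a) ∧
      (∀ a (h : a < m), ∀ x ∈ (biworlds a : Set (Raw Atom Agent a)),
        ∃ w ∈ biworlds m, restrict m a h.le w = x) ∧
      (∀ a (h : a < m), ∀ w₁ ∈ (biworlds m : Set (Raw Atom Agent m)), ∀ w₂ ∈ biworlds m,
        ¬ Incompleted a (restrict m a h.le w₁) → restrict m a h.le w₁ = restrict m a h.le w₂ →
        w₁ = w₂) by
    obtain ⟨h1, h2, h3⟩ := h
    refine ⟨h1, fun a h x hx => ?_, fun a h w₁ hw₁ w₂ hw₂ hc he => ?_, fun a h w hw hc => ?_⟩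
    · rcases h.eq_or_lt with rfl | h
      · exact ⟨x, hx, restrict_self (biworlds_subset_prebiworlds hx)⟩
      · exact h2 a h x hx
    · rcases h.eq_or_lt with rfl | h
      · rwa [restrict_self (biworlds_subset_prebiworlds hw₁),
          restrict_self (biworlds_subset_prebiworlds hw₂)] at he
      · exact h3 a h w₁ hw₁ w₂ hw₂ hc he
    · exact not_incompleted_of_restrict hω h (fun h => ih a h (h.trans hω)) h1 hw hc
  rcases zero_or_add_one_or_isSuccLimit m with rfl | ⟨m, rfl⟩ | hl
  · refine ⟨fun w hw a h => ?_, fun a h => absurd h not_lt_bot, fun a h => absurd h not_lt_bot⟩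
    obtain rfl : a = 0 := le_antisymm h (by simp)
    rwa [restrict_self (biworlds_subset_prebiworlds hw)]
  · have hm := lt_add_one m
    have H := ih m hm (hm.trans hω)
    have hR : ∀ w ∈ (biworlds (m + 1) : Set (Raw Atom Agent (m + 1))), ∀ a h,
        restrict (m + 1) a h w ∈ biworlds a := by
      intro w hw a h
      have hwp := biworlds_subset_prebiworlds hw
      induction a using Ordinal.limitRecOn with
      | zero => rw [biworlds_zero]; trivial
      | add_one a _ =>
        have ham := le_of_add_one_le h
        refine mem_biworlds_succ.2 ⟨restrict_mem_prebiworlds h hwp, fun A => ?_, fun A x => ?_⟩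
        · rw [poss_restrict, imposs_restrict, ← Set.image_union, (mem_biworlds_succ.1 hw).2.1 A]
          refine Set.Subset.antisymm (Set.image_subset_iff.2 fun x hx => H.restrict_mem x hx _ _)
            fun x hx => ?_
          obtain ⟨y, hy, rfl⟩ := H.exists_ext a ham x hx
          exact Set.mem_image_of_mem _ hy
        · rw [poss_restrict, imposs_restrict]
          rintro ⟨u, hu, rfl⟩ ⟨u', hu', he⟩
          -- Were the common restriction completed, uniqueness would identify the possible `u` with
          -- the impossible `u'`; this object would be both ambiguous and completed.
          by_contra hc
          have hub := poss_subset_biworlds hw A hu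
          obtain rfl := H.unique a ham u hub u' (imposs_subset_biworlds hw A hu') hc he.symm
          exact H.completed a ham u hub hc ((mem_biworlds_succ.1 hw).2.2 A u hu hu')
      | limit a ha iha =>
        refine (mem_biworlds_limit ha).2 ⟨restrict_mem_prebiworlds h hwp, fun b hb => ?_⟩
        rw [proj_restrict]
        exact iha b hb _
    refine ⟨hR, fun a h x hx => ?_, fun a h w₁ hw₁ w₂ hw₂ hc he => ?_⟩
    · have ham := lt_add_one_iff.1 h
      obtain ⟨y, hy, rfl⟩ := H.exists_ext a ham x hx
      obtain ⟨v, hv, rfl, -⟩ := exists_decided_extension (hm.trans hω) H hy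
      exact ⟨v, hv, (restrict_restrict _ _ (biworlds_subset_prebiworlds hv)).symm⟩
    · have ham := lt_add_one_iff.1 h
      rw [← restrict_restrict ham hm.le (biworlds_subset_prebiworlds hw₁)] at hc he
      rw [← restrict_restrict ham hm.le (biworlds_subset_prebiworlds hw₂)] at he
      have hr₁ := hR w₁ hw₁ m hm.le
      have hr := H.unique a ham _ hr₁ _ (hR w₂ hw₂ m hm.le) hc he
      by_contra hne
      exact H.completed a ham _ hr₁ hc (incompleted_iff.2
        ⟨biworlds_subset_prebiworlds hr₁, w₁, hw₁, w₂, hw₂, hne, rfl, hr.symm⟩)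
  · have H : ∀ a < m, Regular Atom Agent a := fun a ha => ih a ha (ha.trans hω)
    refine ⟨fun w hw a h => ?_, fun a h x hx => ?_, fun a h w₁ hw₁ w₂ hw₂ hc he => ?_⟩
    · have hwp := biworlds_subset_prebiworlds hw
      rcases h.eq_or_lt with rfl | h
      · rwa [restrict_self hwp]
      · rw [restrict_limit hl hwp h]
        exact ((mem_biworlds_limit hl).1 hw).2 a h
    · obtain ⟨w, hw, hwx, hwb⟩ := exists_thread hl hω (fun b => biworlds b)
        (fun b _ => biworlds_subset_prebiworlds)
        (fun a b hab hb w hw => (H b hb).restrict_mem w hw a hab)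
        (fun a b hab hb x hx => (H b hb).exists_ext a hab x hx) h hx
      refine ⟨w, (mem_biworlds_limit hl).2 ⟨hw, fun b hb => ?_⟩, hwx⟩
      rw [← restrict_limit hl hw hb]
      exact hwb b hb
    · have hp₁ := biworlds_subset_prebiworlds hw₁
      have hp₂ := biworlds_subset_prebiworlds hw₂
      refine raw_limit_ext hl fun b hb => ?_
      have hc' := max_lt h hb
      have key : restrict m (max a b) hc'.le w₁ = restrict m (max a b) hc'.le w₂ := by
        refine (H _ hc').unique a (le_max_left a b) _ ?_ _ ?_ ?_ ?_
        · rw [restrict_limit hl hp₁ hc']; exact ((mem_biworlds_limit hl).1 hw₁).2 _ _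
        · rw [restrict_limit hl hp₂ hc']; exact ((mem_biworlds_limit hl).1 hw₂).2 _ _
        · rwa [restrict_restrict _ _ hp₁]
        · rwa [restrict_restrict _ _ hp₁, restrict_restrict _ _ hp₂]
      rw [← restrict_limit hl hp₁ hb, ← restrict_limit hl hp₂ hb,
        ← restrict_restrict (le_max_right a b) hc'.le hp₁, key, restrict_restrict _ _ hp₂]

open Ordinal Cardinal

/-! ### Worlds -/

theorem omega0_sq_lt_omega_one : ω ^ 2 < ω_ (1 : Ordinal.{0}) := by
  rw [lt_omega_iff_card_lt, Cardinal.lt_aleph_one_iff, pow_two, card_mul, card_omega0,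
    Cardinal.aleph0_mul_aleph0]

theorem omega0_sq_add_one_lt_omega_one : ω ^ 2 + 1 < ω_ (1 : Ordinal.{0}) :=
  (isSuccLimit_omega 1).add_one_lt omega0_sq_lt_omega_one

theorem add_lt_omega0_sq {a b : Ordinal.{0}} (ha : a < ω ^ 2) (hb : b < ω ^ 2) :
    a + b < ω ^ 2 := by
  have h := isPrincipal_add_omega0_opow 2
  rw [show (ω ^ (2 : Ordinal.{0}) : Ordinal.{0}) = ω ^ 2 from opow_natCast ω 2] at h
  exact h ha hb

theorem omega0_lt_omega0_sq : (ω : Ordinal.{0}) < ω ^ 2 := by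
  rw [pow_two]
  exact lt_mul_of_one_lt_right omega0_pos one_lt_omega0

/-- An ambiguous object could be resolved by a splitting set or by its complement, giving two
distinct extensions. -/
theorem decided_of_not_incompleted {m : Ordinal.{0}} (hω : m + 1 < ω_ 1)
    {w : Raw Atom Agent (m + 1)} (hw : w ∈ biworlds (m + 1)) (hc : ¬ Incompleted (m + 1) w) :
    Decided w := by
  intro A x hx hx'
  have H : Regular Atom Agent (m + 1) := regular hω
  obtain ⟨E, hE⟩ := exists_splitting_set (Atom := Atom) (Agent := Agent) m
  obtain ⟨v₁, hv₁, hr₁, -, h₁⟩ := exists_decided_extension_succ H hE hw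
  obtain ⟨v₂, hv₂, hr₂, -, h₂⟩ := exists_decided_extension_succ H (E := Eᶜ)
    (fun x hx => ⟨(hE x hx).2, by simpa using (hE x hx).1⟩) hw
  obtain ⟨y, hy, hyE, rfl⟩ := (hE x ((mem_biworlds_succ.1 hw).2.2 A x hx hx')).1
  refine hc (incompleted_iff.2 ⟨biworlds_subset_prebiworlds hw, v₁, hv₁, v₂, hv₂, ?_, hr₁, hr₂⟩)
  rintro rfl
  exact (h₂ A y hy hx hx').1 ((h₁ A y hy hx hx').2 hyE) hyE

theorem World.decided (w : World Atom Agent) : Decided w.1 :=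
  decided_of_not_incompleted omega0_sq_add_one_lt_omega_one w.2.1
    fun h => w.2.2.2 h

theorem World.mem_prebiworlds (w : World Atom Agent) : w.1 ∈ prebiworlds (ω ^ 2 + 1) :=
  biworlds_subset_prebiworlds w.2.1

/-- The restriction of a world to depth `ω ^ 2`. -/
noncomputable def World.base (w : World Atom Agent) : Raw Atom Agent (ω ^ 2) :=
  restrict (ω ^ 2 + 1) (ω ^ 2) (lt_add_one _).le w.1

theorem World.base_mem (w : World Atom Agent) : w.base ∈ biworlds (ω ^ 2) :=
  (regular omega0_sq_add_one_lt_omega_one).restrict_mem _ w.2.1 _ _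

/-- A decided biworld of depth `ω ^ 2 + 1`, as a world. -/
def worldOfDecided (w : Raw Atom Agent (ω ^ 2 + 1)) (hw : w ∈ biworlds (ω ^ 2 + 1))
    (hd : Decided w) : World Atom Agent :=
  ⟨w, hw, biworlds_subset_prebiworlds hw,
    not_incompleted_of_decided (biworlds_subset_prebiworlds hw) hd⟩

theorem exists_world_base_eq {x : Raw Atom Agent (ω ^ 2)} (hx : x ∈ biworlds (ω ^ 2)) :
    ∃ w : World Atom Agent, w.base = x := by
  obtain ⟨v, hv, hvx, hd⟩ :=
    exists_decided_extension omega0_sq_lt_omega_one (regular omega0_sq_lt_omega_one) hx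
  exact ⟨worldOfDecided v hv hd, hvx⟩

/-! ### Truth is determined below depth `ω ^ 2` -/

/-- Membership of a world in `S` depends only on its restriction to the depth `a < ω ^ 2`. -/
def DeterminedAt (a : Ordinal.{0}) (S : World Atom Agent → Prop) : Prop :=
  ∃ h : a < ω ^ 2, ∀ w w' : World Atom Agent,
    restrict (ω ^ 2) a h.le w.base = restrict (ω ^ 2) a h.le w'.base → S w → S w'

theorem DeterminedAt.mono {a b : Ordinal.{0}} {S : World Atom Agent → Prop}
    (hS : DeterminedAt a S) (hab : a ≤ b) (hb : b < ω ^ 2) : DeterminedAt b S := by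
  obtain ⟨ha, hS⟩ := hS
  refine ⟨hb, fun w w' h => hS w w' ?_⟩
  rw [← restrict_restrict hab hb.le (biworlds_subset_prebiworlds w.base_mem), h,
    restrict_restrict hab hb.le (biworlds_subset_prebiworlds w'.base_mem)]

theorem DeterminedAt.not {a : Ordinal.{0}} {S : World Atom Agent → Prop}
    (hS : DeterminedAt a S) : DeterminedAt a (fun w => ¬ S w) := by
  obtain ⟨ha, hS⟩ := hS
  exact ⟨ha, fun w w' h hw hw' => hw (hS w' w h.symm hw')⟩

theorem poss_restrict_base {a : Ordinal.{0}} (ha : a + 1 ≤ ω ^ 2) (h : a ≤ ω ^ 2)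
    (w : World Atom Agent) (A : Agent) :
    poss (restrict (ω ^ 2) (a + 1) ha w.base) A = restrict (ω ^ 2) a h '' poss w.1 A := by
  rw [World.base, restrict_restrict _ _ w.mem_prebiworlds, poss_restrict]

theorem imposs_restrict_base {a : Ordinal.{0}} (ha : a + 1 ≤ ω ^ 2) (h : a ≤ ω ^ 2)
    (w : World Atom Agent) (A : Agent) :
    imposs (restrict (ω ^ 2) (a + 1) ha w.base) A = restrict (ω ^ 2) a h '' imposs w.1 A := by
  rw [World.base, restrict_restrict _ _ w.mem_prebiworlds, imposs_restrict]

theorem one_lt_omega0_sq : (1 : Ordinal.{0}) < ω ^ 2 :=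
  one_lt_omega0.trans omega0_lt_omega0_sq

/-- A successor of `w'` has the same restriction to `a` as some possible object of `w`. That object
extends to a world, so it counts as a successor of `w`. -/
theorem DeterminedAt.knows {a : Ordinal.{0}} {S : World Atom Agent → Prop}
    (hS : DeterminedAt a S) (A : Agent) :
    DeterminedAt (a + 1) (fun w => ∀ w', (canonical Atom Agent).R A w w' → S w') := by
  obtain ⟨ha, hS⟩ := hS
  have ha' := add_lt_omega0_sq ha one_lt_omega0_sq
  refine ⟨ha', fun w w' h hw v hv => ?_⟩
  change World.base v ∈ poss w'.1 A at hv
  have hv' := Set.mem_image_of_mem (restrict (ω ^ 2) a ha.le) hv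
  rw [← poss_restrict_base ha'.le, ← h, poss_restrict_base _ ha.le] at hv'
  obtain ⟨x, hx, hxv⟩ := hv'
  obtain ⟨y, rfl⟩ := exists_world_base_eq (poss_subset_biworlds w.2.1 A hx)
  exact hS y v hxv (hw y hx)

/-- Dual to `knows`, through the impossible sets. Decidedness of `w` is essential: an object found
impossible for `w` must not be possible too. -/
theorem DeterminedAt.knowsAtMost {a : Ordinal.{0}} {S : World Atom Agent → Prop}
    (hS : DeterminedAt a S) (A : Agent) :
    DeterminedAt (a + 1) (fun w => ∀ w', S w' → (canonical Atom Agent).R A w w') := by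
  obtain ⟨ha, hS⟩ := hS
  have ha' := add_lt_omega0_sq ha one_lt_omega0_sq
  refine ⟨ha', fun w w' h hw v hv => ?_⟩
  change World.base v ∈ poss w'.1 A
  refine (mem_poss_or_mem_imposs w'.2.1 A v.base_mem).resolve_right fun hv' => ?_
  replace hv' := Set.mem_image_of_mem (restrict (ω ^ 2) a ha.le) hv'
  rw [← imposs_restrict_base ha'.le, ← h, imposs_restrict_base _ ha.le] at hv'
  obtain ⟨x, hx, hxv⟩ := hv'
  obtain ⟨y, rfl⟩ := exists_world_base_eq (imposs_subset_biworlds w.2.1 A hx)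
  exact w.decided A _ (hw y (hS v y hxv.symm hv)) hx

theorem DeterminedAt.everyoneKnows {a : Ordinal.{0}} {S : World Atom Agent → Prop}
    (hS : DeterminedAt a S) (G : Set Agent) :
    DeterminedAt (a + 1) ((canonical Atom Agent).everyoneKnows G S) := by
  have ha' := add_lt_omega0_sq hS.1 one_lt_omega0_sq
  refine ⟨ha', fun w w' h hw A hA => ?_⟩
  obtain ⟨_, hK⟩ := hS.knows A
  exact hK w w' h (hw A hA)

theorem DeterminedAt.everyoneKnows_iterate {a : Ordinal.{0}} {S : World Atom Agent → Prop}
    (hS : DeterminedAt a S) (G : Set Agent) (k : ℕ) :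
    DeterminedAt (a + k) (((canonical Atom Agent).everyoneKnows G)^[k] S) := by
  induction k with
  | zero =>
    rw [Nat.cast_zero, add_zero]
    exact hS
  | succ k ih =>
    rw [Nat.cast_succ, ← add_assoc]
    exact (congrArg (DeterminedAt _) (Function.iterate_succ_apply' _ k S)).mpr
      (ih.everyoneKnows G)

theorem exists_determinedAt_sat (φ : Formula Atom Agent) :
    ∃ a, DeterminedAt a ((canonical Atom Agent).Sat φ) := by
  have hpos : (0 : Ordinal.{0}) < ω ^ 2 := zero_lt_one.trans one_lt_omega0_sq
  induction φ with
  | atom p =>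
    refine ⟨0, hpos, fun w w' h hw => ?_⟩
    have key : obj (ω ^ 2 + 1) w.1 = obj (ω ^ 2 + 1) w'.1 := by
      rw [← obj_restrict (lt_add_one _).le w.mem_prebiworlds,
        ← obj_restrict (lt_add_one _).le w'.mem_prebiworlds, ← obj_restrict_zero hpos.le,
        ← obj_restrict_zero hpos.le]
      exact congrArg (obj 0) h
    change p ∈ obj (ω ^ 2 + 1) w'.1
    rw [← key]
    exact hw
  | bot => exact ⟨0, hpos, fun _ _ _ hw => hw⟩
  | neg φ ih =>
    obtain ⟨a, ha⟩ := ih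
    exact ⟨a, ha.not⟩
  | and φ ψ ihφ ihψ =>
    obtain ⟨a, ha⟩ := ihφ
    obtain ⟨b, hb⟩ := ihψ
    have hmax := max_lt ha.1 hb.1
    obtain ⟨_, ha⟩ := ha.mono (le_max_left a b) hmax
    obtain ⟨_, hb⟩ := hb.mono (le_max_right a b) hmax
    exact ⟨max a b, hmax, fun w w' h hw => ⟨ha w w' h hw.1, hb w w' h hw.2⟩⟩
  | K A φ ih =>
    obtain ⟨a, ha⟩ := ih
    exact ⟨a + 1, ha.knows A⟩
  | M A φ ih =>
    obtain ⟨a, ha⟩ := ih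
    exact ⟨a + 1, ha.knowsAtMost A⟩
  | E G φ ih =>
    obtain ⟨a, ha⟩ := ih
    exact ⟨a + 1, ha.everyoneKnows G⟩
  | C G φ ih =>
    obtain ⟨a, ha⟩ := ih
    have ha' := add_lt_omega0_sq ha.1 omega0_lt_omega0_sq
    -- The `k`-th iterate is determined at `a + k`; `a + ω` bounds all of these at once.
    refine ⟨a + ω, ha', fun w w' h hw k hk => ?_⟩
    obtain ⟨_, hS⟩ := (ha.everyoneKnows_iterate G k).mono
      (by gcongr; exact (natCast_lt_omega0 k).le) ha'
    exact hS w w' h (hw k hk)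

theorem exists_sat_O (A : Agent) (φ : Formula Atom Agent) :
    ∃ w : World Atom Agent, (canonical Atom Agent).Sat (Formula.O A φ) w := by
  obtain ⟨a, ha, hφ⟩ := exists_determinedAt_sat φ
  let P : Set (Raw Atom Agent (ω ^ 2)) :=
    World.base '' {w | (canonical Atom Agent).Sat φ w}
  have hP : P ⊆ biworlds (ω ^ 2) := Set.image_subset_iff.2 fun w _ => w.base_mem
  have hposs : ∀ w : World Atom Agent,
      w.base ∈ poss (mkSucc (∅ : Set Atom) (fun _ : Agent => P)
        (fun _ => biworlds (ω ^ 2) \ P)) A ↔ w.base ∈ P := fun w => by rw [poss_mkSucc]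
  -- The empty interpretation and the sets of the other agents are arbitrary choices; only the
  -- component of `A` matters.
  refine ⟨worldOfDecided _ (mkSucc_diff_mem_biworlds ∅ (P := fun _ : Agent => P) fun _ => hP)
    (decided_mkSucc_diff _ _), fun w hw => ?_, fun w hw => ?_⟩
  · obtain ⟨v, hv, hvw⟩ := (hposs w).1 hw
    exact hφ v w (congrArg (restrict (ω ^ 2) a ha.le) hvw) hv
  · exact (hposs w).2 (Set.mem_image_of_mem _ hw)

/-! ### Kripke structures -/

theorem KripkeStructure.sat_subst (𝒦 : KripkeStructure Atom Agent) (s : ℕ → Formula Atom Agent)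
    (τ : PropFormula) (w : 𝒦.World) :
    𝒦.Sat (τ.subst s) w ↔ τ.Holds fun n => 𝒦.Sat (s n) w := by
  induction τ with
  | var n => rfl
  | bot => rfl
  | neg τ ih => exact not_congr ih
  | and τ σ ihτ ihσ => exact and_congr ihτ ihσ

theorem KripkeStructure.sat_imp (𝒦 : KripkeStructure Atom Agent) (φ ψ : Formula Atom Agent)
    (w : 𝒦.World) : 𝒦.Sat (φ.imp ψ) w ↔ (𝒦.Sat φ w → 𝒦.Sat ψ w) := by
  change ¬ (𝒦.Sat φ w ∧ ¬ 𝒦.Sat ψ w) ↔ _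
  tauto

theorem KripkeStructure.sat_iff (𝒦 : KripkeStructure Atom Agent) (φ ψ : Formula Atom Agent)
    (w : 𝒦.World) : 𝒦.Sat (φ.iff ψ) w ↔ (𝒦.Sat φ w ↔ 𝒦.Sat ψ w) := by
  change 𝒦.Sat (φ.imp ψ) w ∧ 𝒦.Sat (ψ.imp φ) w ↔ _
  rw [sat_imp, sat_imp]
  exact iff_iff_implies_and_implies.symm

theorem KripkeStructure.sat_C_iff (𝒦 : KripkeStructure Atom Agent) (G : Set Agent)
    (φ : Formula Atom Agent) (w : 𝒦.World) :
    𝒦.Sat (.C G φ) w ↔ 𝒦.Sat (.E G (φ.and (.C G φ))) w := by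
  constructor
  · intro h A hA w' hw'
    refine ⟨h 1 le_rfl A hA w' hw', fun k hk => ?_⟩
    have := h (k + 1) (by omega)
    rw [Function.iterate_succ_apply'] at this
    exact this A hA w' hw'
  · intro h k hk
    obtain ⟨k, rfl⟩ := Nat.exists_eq_add_of_le' hk
    rw [Function.iterate_succ_apply']
    intro A hA w' hw'
    -- Common knowledge starts at the first iterate, so the zeroth one has to come from the conjunct
    -- `φ`.
    rcases k.eq_zero_or_pos with rfl | hk
    · exact (h A hA w' hw').1
    · exact (h A hA w' hw').2 k hk

theorem KripkeStructure.sat_C_of_forall_sat (𝒦 : KripkeStructure Atom Agent) (G : Set Agent)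
    (φ ψ : Formula Atom Agent) (h : ∀ w, 𝒦.Sat φ w → 𝒦.Sat (.E G (φ.and ψ)) w) (w : 𝒦.World)
    (hw : 𝒦.Sat φ w) : 𝒦.Sat (.C G ψ) w := by
  intro k hk
  induction k, hk using Nat.le_induction generalizing w with
  | base => exact fun A hA w' hw' => (h w hw A hA w' hw').2
  | succ k _ ih =>
    rw [Function.iterate_succ_apply']
    exact fun A hA w' hw' => ih w' (h w hw A hA w' hw').1

end COL

-- The logical properties of entailment

open COL
theorem theorem5 (Atom : Type*) (Agent : Type*) :
    -- (Prop)
    (∀ φ : Formula Atom Agent, φ.IsTautology → Entails ∅ φ) ∧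
    -- (MP)
    (∀ φ ψ : Formula Atom Agent, Entails {φ, φ.imp ψ} ψ) ∧
    -- (Mono)
    (∀ (Γ : Set (Formula Atom Agent)) (φ ψ : Formula Atom Agent),
      Entails Γ φ → Entails (Γ ∪ {ψ}) φ) ∧
    -- (Cut)
    (∀ (Γ Γ' : Set (Formula Atom Agent)) (φ ψ : Formula Atom Agent),
      Entails Γ φ → Entails (Γ' ∪ {φ}) ψ → Entails (Γ ∪ Γ') ψ) ∧
    -- (K)
    (∀ (A : Agent) (φ ψ : Formula Atom Agent),
      Entails ∅ (((Formula.K A (φ.imp ψ)).and (Formula.K A φ)).imp (Formula.K A ψ))) ∧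
    -- (Nec)
    (∀ (A : Agent) (φ : Formula Atom Agent), Entails ∅ φ → Entails ∅ (Formula.K A φ)) ∧
    -- (M)
    (∀ (A : Agent) (φ ψ : Formula Atom Agent),
      ¬ Entails {φ} ψ → Entails {Formula.M A φ} (Formula.neg (Formula.K A ψ))) ∧
    -- (O)
    (∀ (A : Agent) (φ : Formula Atom Agent), ¬ Entails {Formula.O A φ} Formula.bot) ∧
    -- (fixed point axiom)
    (∀ (G : Set Agent), G.Nonempty → ∀ φ : Formula Atom Agent,
      Entails ∅ ((Formula.C G φ).iff (Formula.E G (φ.and (Formula.C G φ))))) ∧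
    -- (induction rule)
    (∀ (G : Set Agent), G.Nonempty → ∀ φ ψ : Formula Atom Agent,
      Entails {φ} (Formula.E G (φ.and ψ)) → Entails {φ} (Formula.C G ψ)) := by
  refine ⟨?_, ?_, ?_, ?_, ?_, ?_, ?_, ?_, ?_, ?_⟩
  · rintro _ ⟨τ, s, h, rfl⟩ w _
    exact (KripkeStructure.sat_subst _ s τ w).2 (h _)
  · intro φ ψ w hw
    exact (KripkeStructure.sat_imp _ φ ψ w).1 (hw _ (by simp)) (hw _ (by simp))
  · intro Γ φ ψ h w hw
    exact h w fun χ hχ => hw χ (.inl hχ)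
  · intro Γ Γ' φ ψ h h' w hw
    refine h' w ?_
    rintro χ (hχ | rfl)
    · exact hw χ (.inr hχ)
    · exact h w fun χ hχ => hw χ (.inl hχ)
  · intro A φ ψ w _
    rw [KripkeStructure.sat_imp]
    intro h w' hw'
    exact (KripkeStructure.sat_imp _ φ ψ w').1 (h.1 w' hw') (h.2 w' hw')
  · intro A φ h w _ w' _
    exact h w' fun χ hχ => absurd hχ (Set.notMem_empty χ)
  · intro A φ ψ h w hw hK
    -- Any world satisfying `φ` is accessible by `M_A φ`, hence satisfies `ψ` by `K_A ψ`; this would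
    -- be the excluded entailment.
    refine h fun w' hw' => ?_
    exact hK w' (hw _ rfl w' (hw' φ rfl))
  · intro A φ h
    obtain ⟨w, hw⟩ := exists_sat_O A φ
    exact h w fun χ hχ => by
      obtain rfl := hχ
      exact hw
  · intro G _ φ w _
    exact (KripkeStructure.sat_iff _ _ _ w).2 (KripkeStructure.sat_C_iff _ G φ w)
  · intro G _ φ ψ h w hw
    exact KripkeStructure.sat_C_of_forall_sat _ G φ ψ
      (fun w hw => h w fun χ hχ => by obtain rfl := hχ; exact hw) w (hw φ rfl)
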